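/- **Second Main Theorem.** Let $f$ be a nonconstant meromorphic function in $\mathbb{C}$. For points $w, b\in\mathbb C$ let $$[w,b]=\frac{|w-b|}{\sqrt{1+|w|^2}\sqrt{1+|b|^2}},\qquad [w,\infty]=\frac{1}{\sqrt{1+|w|^2}}$$ denote the chordal distance, and for $a$ in the Riemann sphere $\overline{\mathbb C}=\mathbb{C}\cup\{\infty\}$ and $r>0$ let $$m(r,a)=\frac1{2\pi}\int_{-\pi}^{\pi}\log\frac{1}{[f(re^{i\theta}),a]}\,d\theta .$$ Let $n(r,a)$ be the number of solutions of $f(z)=a$ in $\{|z|\le r\}$, counted with multiplicity, and let $n_1(r)$ be the number of critical points of $f$ in $\{|z|\le r\}$, where a point at which $f$ takes its value (possibly $\infty$) with multiplicity $k$ is counted $k-1$ times. Put $$N(r,a)=\int_0^r\frac{n(t,a)-n(0,a)}{t}\,dt+n(0,a)\log r,\qquad N_1(r)=\int_0^r\frac{n_1(t)-n_1(0)}{t}\,dt+n_1(0)\log r,$$ and let $$T(r)=\int_{\mathbb{C}}N(r,a)\,\frac{du\,dv}{\pi(1+|a|^2)^2}\qquad(a=u+iv)$$ be the (Ahlfors–Shimizu)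 characteristic of $f$. Then for every finite set $\{a_1,\dots,a_q\}\subset\overline{\mathbb C}$ of distinct points there is a function $S$ (depending on $f$ and on $a_1,\dots,a_q$) such that $$\sum_{j=1}^q m(r,a_j)+N_1(r)\le 2T(r)+S(r)\qquad\text{for all } r>0,$$ and a measurable set $E\subset[0,\infty)$ of finite Lebesgue measure such that $S(r)=o(T(r))$ as $r\to\infty$, $r\notin E$. -/

import Mathlib

open MeasureTheory Filter Topology Real Function

namespace Nevanlinna

/-! A meromorphic function in the plane is given by `f : ℂ → ℂ` with `Meromorphic f`.  The values
that Lean assigns to `f` at its poles (or on any other closed discrete set) are irrelevant: all the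
quantities below depend only on `f` off a closed discrete set. -/

/-- The chordal distance `[w, a]` between a finite point `w` and a point `a` of the Riemann sphere,
normalised so that the sphere has diameter `1`. -/
noncomputable def chordalDist (w : ℂ) (a : OnePoint ℂ) : ℝ :=
  a.elim (1 / √(1 + ‖w‖ ^ 2)) fun b ↦ ‖w - b‖ / (√(1 + ‖w‖ ^ 2) * √(1 + ‖b‖ ^ 2))

/-- The proximity function `m(r, a)`: the mean over `|z| = r` of `log (1 / [f(z), a])`. -/
noncomputable def proximity (f : ℂ → ℂ) (a : OnePoint ℂ) (r : ℝ) : ℝ :=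
  circleAverage (fun z ↦ log (1 / chordalDist (f z) a)) 0 r

/-- The (Ahlfors–Shimizu) characteristic `T(r)`: the mean of the integrated counting functions
`N(r, a)` with respect to the normalised spherical area
`du dv / (π (1 + |a|²)²)`, `a = u + i v`. The point at infinity has area zero. -/
noncomputable def characteristic (f : ℂ → ℂ) (r : ℝ) : ℝ :=
  ∫ a : ℂ, ValueDistribution.logCounting f (a : WithTop ℂ) r * (1 / (π * (1 + ‖a‖ ^ 2) ^ 2))

/-- The multiplicity with which `f` takes its value at `z`: at a pole the order of the pole, at any
other point the order of the zero of `f - f(z)`, where `f(z)` is read as the limit of `f` at `z`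
(and `0` if `f` is constant near `z`). -/
noncomputable def localMultiplicity (f : ℂ → ℂ) (z : ℂ) : ℕ :=
  if meromorphicOrderAt f z < 0 then (-(meromorphicOrderAt f z).untop₀).toNat
  else (meromorphicOrderAt (fun w ↦ f w - limUnder (𝓝[≠] z) f) z).untop₀.toNat

theorem localMultiplicity_of_analyticAt {f : ℂ → ℂ} {z : ℂ} (hf : AnalyticAt ℂ f z) :
    localMultiplicity f z = (analyticOrderAt (fun w ↦ f w - f z) z).toNat := by
  have hlim : limUnder (𝓝[≠] z) f = f z :=
    (hf.continuousAt.tendsto.mono_left nhdsWithin_le_nhds).limUnder_eq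
  have hg : AnalyticAt ℂ (fun w ↦ f w - f z) z := hf.sub analyticAt_const
  rw [localMultiplicity, if_neg (not_lt.2 hf.meromorphicOrderAt_nonneg), hlim,
    hg.meromorphicOrderAt_eq]
  cases analyticOrderAt (fun w ↦ f w - f z) z <;> simp

theorem localMultiplicity_le_one_of_deriv_ne_zero {f : ℂ → ℂ} {z : ℂ} (hf : AnalyticAt ℂ f z)
    (hd : deriv f z ≠ 0) : localMultiplicity f z ≤ 1 := by
  rw [localMultiplicity_of_analyticAt hf, hf.analyticOrderAt_sub_eq_one_of_deriv_ne_zero hd]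
  simp

theorem localMultiplicity_of_eventually_const {f : ℂ → ℂ} {z : ℂ} (hf : AnalyticAt ℂ f z)
    (hd : ∀ᶠ w in 𝓝 z, deriv f w = 0) : localMultiplicity f z = 0 := by
  rw [localMultiplicity_of_analyticAt hf, ← hf.analyticOrderAt_deriv_add_one,
    analyticOrderAt_eq_top.2 hd]
  simp

/-- The critical points of `f`, a point where `f` has multiplicity `m` being counted `m - 1`
times. -/
noncomputable def criticalDivisor (f : ℂ → ℂ) (hf : Meromorphic f) : locallyFinsupp ℂ ℤ where
  toFun z := ((localMultiplicity f z - 1 : ℕ) : ℤ)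
  supportWithinDomain' := Set.subset_univ _
  supportLocallyFiniteWithinDomain' z _ := by
    have h : ∀ᶠ w in 𝓝[≠] z, localMultiplicity f w ≤ 1 := by
      have ha := (hf z).eventually_analyticAt
      rcases (hf z).deriv.eventually_eq_zero_or_eventually_ne_zero with h0 | h0
      · filter_upwards [ha, eventually_eventually_nhdsWithin.2 h0, self_mem_nhdsWithin]
          with w h1 h2 h3
        rw [(isOpen_compl_singleton.nhdsWithin_eq h3)] at h2
        exact (localMultiplicity_of_eventually_const h1 h2).trans_le zero_le_one
      · filter_upwards [ha, h0] with w h1 h2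
        exact localMultiplicity_le_one_of_deriv_ne_zero h1 h2
    refine ⟨_, eventually_nhdsWithin_iff.1 h, (Set.finite_singleton z).subset ?_⟩
    rintro w ⟨hw, hs⟩
    by_contra hne
    have := hw hne
    simp only [mem_support] at hs
    omega

/-- The integrated counting function `N₁(r)` of the critical points. -/
noncomputable def ramificationCounting (f : ℂ → ℂ) (hf : Meromorphic f) (r : ℝ) : ℝ :=
  (criticalDivisor f hf).logCounting r

end Nevanlinna

/-!
The proof is Ahlfors' averaging argument, in the form that uses a singular mass distribution on the
Riemann sphere.

*First main theorem.* Jensen's formula for `f - a` gives `N(r, a) + m(r, a) = T₀(r) + O(1)` with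
`T₀(r) = N(r, ∞) + m(r, ∞)` (`sphericalCharacteristic`, `logCounting_add_proximity`). The bounded
term `jensenConstant f a` has only a logarithmic singularity in `a`. Since the mean of `m(r, a)` over
the sphere is bounded, `T₀` differs from the characteristic `T` by a bounded function
(`exists_abs_characteristic_sub_le`), and `T₀` is used throughout.

*Area estimate.* For `0 < s < 2` the weight `p(w) = 1 + ∑ [w, a]^(-s)` (`targetWeight`) is integrable
against the spherical area. Integrating `N(r, a)` against `p(a)` times that area, and changing
variables by `a = f(z)`, gives
`∫ log⁺ (r / |z|) p(f z) |f' z|² / (π (1 + |f z|²)²) dx dy ≤ C₁ T₀(r) + C₂`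
(`exists_lintegral_area_le`). In polar coordinates the left side is a twofold integral of the circle
means of the integrand `W` (`pullbackDensity`), so that two applications of Borel's growth lemma bound
the circle mean of `W` by `(2 r)^δ` times a multiple of `T₀(r)⁴`, off a set of radii of finite measure
(`exists_le_logMean`, `exists_lintegral_pullbackDensity_le`).

*Logarithmic estimate.* By concavity of the logarithm, the mean of `log W` is at most the logarithm of
the mean of `W`. On the other hand `log p ≥ s ∑ log (1 / [f, a]) - C`, because `f` can be close to at
most one of the points `a`; and Jensen's formula for `f'` turns the mean of `log |f'|²` into
`2 N₁(r) - 4 N(r, ∞) + O(1)` (`circleAverage_log_norm_deriv`). Hence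
`s ∑ m(r, a) + 2 N₁(r) ≤ 4 T₀(r) + log (mean of W) + O(1)` (`exists_sum_proximity_le_log`). As `s` may
be as close to `2` as desired and `log r = O(T₀(r))`, this is the theorem with error term `η T(r)` for
every `η > 0`, and a diagonal argument over `η` makes it `o(T(r))`.
-/

namespace Nevanlinna

/-! ### The chordal distance -/

lemma chordalDist_coe (w b : ℂ) :
    chordalDist w (b : OnePoint ℂ) = ‖w - b‖ / (√(1 + ‖w‖ ^ 2) * √(1 + ‖b‖ ^ 2)) := rfl

lemma chordalDist_infty (w : ℂ) : chordalDist w OnePoint.infty = 1 / √(1 + ‖w‖ ^ 2) := rfl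

lemma sqrt_one_add_norm_sq_pos (w : ℂ) : 0 < √(1 + ‖w‖ ^ 2) := by positivity

lemma one_le_sqrt_one_add_norm_sq (w : ℂ) : 1 ≤ √(1 + ‖w‖ ^ 2) :=
  Real.one_le_sqrt.2 (by nlinarith [sq_nonneg ‖w‖])

lemma chordalDist_nonneg (w : ℂ) (a : OnePoint ℂ) : 0 ≤ chordalDist w a := by
  induction a using OnePoint.rec with
  | infty => rw [chordalDist_infty]; positivity
  | coe b => rw [chordalDist_coe]; positivity

lemma chordalDist_pos {w : ℂ} {a : OnePoint ℂ} (h : (w : OnePoint ℂ) ≠ a) :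
    0 < chordalDist w a := by
  induction a using OnePoint.rec with
  | infty => rw [chordalDist_infty]; positivity
  | coe b =>
    have : 0 < ‖w - b‖ := norm_pos_iff.2 (sub_ne_zero.2 fun hw ↦ h (by rw [hw]))
    rw [chordalDist_coe]; positivity

lemma chordalDist_le_one (w : ℂ) (a : OnePoint ℂ) : chordalDist w a ≤ 1 := by
  induction a using OnePoint.rec with
  | infty =>
    rw [chordalDist_infty, div_le_one (by positivity)]
    exact one_le_sqrt_one_add_norm_sq w
  | coe b =>
    rw [chordalDist_coe, div_le_one (by positivity), ← Real.sqrt_mul (by positivity)]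
    apply Real.le_sqrt_of_sq_le
    have := norm_sub_le w b
    nlinarith [sq_nonneg (1 - ‖w‖ * ‖b‖), norm_nonneg w, norm_nonneg b, norm_nonneg (w - b)]

lemma chordalDist_comm (w b : ℂ) : chordalDist w b = chordalDist b w := by
  rw [chordalDist_coe, chordalDist_coe, norm_sub_rev, mul_comm]

lemma log_one_div_chordalDist_nonneg (w : ℂ) (a : OnePoint ℂ) :
    0 ≤ log (1 / chordalDist w a) := by
  rw [one_div, Real.log_inv]
  exact neg_nonneg.2 (Real.log_nonpos (chordalDist_nonneg w a) (chordalDist_le_one w a))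

lemma log_one_div_chordalDist_coe {w b : ℂ} (h : w ≠ b) :
    log (1 / chordalDist w b) = log √(1 + ‖w‖ ^ 2) + log √(1 + ‖b‖ ^ 2) - log ‖w - b‖ := by
  have : ‖w - b‖ ≠ 0 := by simpa [sub_eq_zero] using h
  rw [chordalDist_coe, one_div_div, Real.log_div (by positivity) this,
    Real.log_mul (by positivity) (by positivity)]

lemma log_one_div_chordalDist_infty (w : ℂ) :
    log (1 / chordalDist w OnePoint.infty) = log √(1 + ‖w‖ ^ 2) := by
  rw [chordalDist_infty, one_div_one_div]

/-- Triangle inequality through a third finite point. It is the triangle inequality in `ℂ²` for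
`(a - b) • (1, w) = (w - b) • (1, a) + (a - w) • (1, b)`. -/
lemma chordalDist_triangle_coe (w a b : ℂ) :
    chordalDist a b ≤ chordalDist w a + chordalDist w b := by
  let v : ℂ → WithLp 2 (ℂ × ℂ) := fun x ↦ WithLp.toLp 2 (1, x)
  have hv : ∀ x, ‖v x‖ = √(1 + ‖x‖ ^ 2) := fun x ↦ by
    simp [v, WithLp.prod_norm_eq_of_L2]
  have key : (a - b) • v w = (w - b) • v a + (a - w) • v b := by
    apply (WithLp.equiv 2 (ℂ × ℂ)).injective
    ext <;> simp [v]; ring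
  have h1 : ‖a - b‖ * √(1 + ‖w‖ ^ 2) ≤
      ‖w - b‖ * √(1 + ‖a‖ ^ 2) + ‖w - a‖ * √(1 + ‖b‖ ^ 2) := by
    have := norm_add_le ((w - b) • v a) ((a - w) • v b)
    rw [← key, norm_smul, norm_smul, norm_smul, hv, hv, hv, norm_sub_rev a w] at this
    exact this
  simp only [chordalDist_coe]
  have hw := sqrt_one_add_norm_sq_pos w
  have ha := sqrt_one_add_norm_sq_pos a
  have hb := sqrt_one_add_norm_sq_pos b
  rw [div_add_div _ _ (by positivity) (by positivity), div_le_div_iff₀ (by positivity)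
    (by positivity)]
  have := mul_le_mul_of_nonneg_right h1
    (show 0 ≤ √(1 + ‖a‖ ^ 2) * √(1 + ‖b‖ ^ 2) * √(1 + ‖w‖ ^ 2) by positivity)
  nlinarith [this]

lemma chordalDist_triangle_infty (w a : ℂ) :
    chordalDist a OnePoint.infty ≤ chordalDist w a + chordalDist w OnePoint.infty := by
  have h1 : √(1 + ‖w‖ ^ 2) ≤ √(1 + ‖a‖ ^ 2) + ‖w - a‖ := by
    apply Real.sqrt_le_iff.2 ⟨by positivity, ?_⟩
    have h2 : ‖w‖ ≤ ‖a‖ + ‖w - a‖ := by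
      simpa [add_comm] using norm_add_le (w - a) a
    have h3 : ‖a‖ ≤ √(1 + ‖a‖ ^ 2) := Real.le_sqrt_of_sq_le (by linarith)
    have h4 : √(1 + ‖a‖ ^ 2) ^ 2 = 1 + ‖a‖ ^ 2 := Real.sq_sqrt (by positivity)
    nlinarith [norm_nonneg (w - a), norm_nonneg a, norm_nonneg w]
  simp only [chordalDist_coe, chordalDist_infty]
  have hw := sqrt_one_add_norm_sq_pos w
  have ha := sqrt_one_add_norm_sq_pos a
  rw [div_add_div _ _ (by positivity) (by positivity), div_le_div_iff₀ (by positivity)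
    (by positivity)]
  have := mul_le_mul_of_nonneg_right h1
    (show 0 ≤ √(1 + ‖a‖ ^ 2) * √(1 + ‖w‖ ^ 2) by positivity)
  nlinarith [this]

/-- No point is chordally close to two distinct points of the sphere. -/
lemma exists_le_chordalDist_add {a b : OnePoint ℂ} (h : a ≠ b) :
    ∃ c > 0, ∀ w : ℂ, c ≤ chordalDist w a + chordalDist w b := by
  induction a using OnePoint.rec with
  | infty =>
    induction b using OnePoint.rec with
    | infty => exact absurd rfl h
    | coe b =>
      exact ⟨chordalDist b OnePoint.infty, chordalDist_pos h.symm, fun w ↦ by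
        rw [add_comm]; exact chordalDist_triangle_infty w b⟩
  | coe a =>
    induction b using OnePoint.rec with
    | infty =>
      exact ⟨chordalDist a OnePoint.infty, chordalDist_pos h, fun w ↦
        chordalDist_triangle_infty w a⟩
    | coe b =>
      exact ⟨chordalDist a b, chordalDist_pos h, fun w ↦ chordalDist_triangle_coe w a b⟩

/-- Distinct targets are separated uniformly: some `K` bounds `log (1 / [w, ·])` at all targets but
one. -/
lemma exists_log_one_div_chordalDist_le (A : Finset (OnePoint ℂ)) :
    ∃ K : ℝ, 0 ≤ K ∧ ∀ w : ℂ, ∀ a ∈ A, ∀ b ∈ A, a ≠ b →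
      min (log (1 / chordalDist w a)) (log (1 / chordalDist w b)) ≤ K := by
  have h1 : ∀ p : OnePoint ℂ × OnePoint ℂ, ∃ K : ℝ, p.1 ≠ p.2 → ∀ w : ℂ,
      min (log (1 / chordalDist w p.1)) (log (1 / chordalDist w p.2)) ≤ K := by
    rintro ⟨a, b⟩
    by_cases hab : a = b
    · exact ⟨0, fun h ↦ absurd hab h⟩
    obtain ⟨c, hc, hcw⟩ := exists_le_chordalDist_add hab
    refine ⟨log (1 / (c / 2)), fun _ w ↦ ?_⟩
    have aux : ∀ x : OnePoint ℂ, c / 2 ≤ chordalDist w x →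
        log (1 / chordalDist w x) ≤ log (1 / (c / 2)) := fun x hx ↦
      Real.log_le_log (one_div_pos.2 (by linarith)) (one_div_le_one_div_of_le (by linarith) hx)
    rcases le_or_gt (c / 2) (chordalDist w a) with h | h
    · exact (min_le_left _ _).trans (aux a h)
    · exact (min_le_right _ _).trans (aux b (by linarith [hcw w]))
  choose K hK using h1
  refine ⟨∑ p ∈ A ×ˢ A, |K p|, Finset.sum_nonneg fun _ _ ↦ abs_nonneg _,
    fun w a ha b hb hab ↦ (hK (a, b) hab w).trans ((le_abs_self _).trans ?_)⟩
  exact Finset.single_le_sum (f := fun p ↦ |K p|) (fun _ _ ↦ abs_nonneg _)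
    (Finset.mk_mem_product ha hb)

/-- The weight `p(w) = 1 + ∑ [w, a]⁻ˢ`, singular at the targets. For `s < 2` it is
integrable with respect to the spherical area. At a target `a` itself the summand is `0 ^ (-s) = 0`,
which does not matter because `f` takes the value `a` only on a closed discrete set. -/
noncomputable def targetWeight (A : Finset (OnePoint ℂ)) (s : ℝ) (w : ℂ) : ℝ :=
  1 + ∑ a ∈ A, chordalDist w a ^ (-s)

lemma one_le_targetWeight (A : Finset (OnePoint ℂ)) (s : ℝ) (w : ℂ) : 1 ≤ targetWeight A s w :=
  le_add_of_nonneg_right (Finset.sum_nonneg fun a _ ↦ Real.rpow_nonneg (chordalDist_nonneg w a) _)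

/-- Since at most one of the chordal distances to the targets is small, the logarithm of the sum
`targetWeight` controls the sum of the logarithms. -/
lemma exists_sum_log_one_div_chordalDist_le (A : Finset (OnePoint ℂ)) {s : ℝ} (hs : 0 < s) :
    ∃ C : ℝ, ∀ w : ℂ, (∀ a ∈ A, (w : OnePoint ℂ) ≠ a) →
      s * ∑ a ∈ A, log (1 / chordalDist w a) ≤ log (targetWeight A s w) + C := by
  classical
  obtain ⟨K, hK0, hK⟩ := exists_log_one_div_chordalDist_le A
  refine ⟨s * (A.card * K), fun w hw ↦ ?_⟩
  rcases A.eq_empty_or_nonempty with rfl | hne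
  · simp [targetWeight]
  obtain ⟨a, ha, hmax⟩ := A.exists_max_image (fun a ↦ log (1 / chordalDist w a)) hne
  have h1 : ∑ b ∈ A.erase a, log (1 / chordalDist w b) ≤ A.card * K := by
    calc ∑ b ∈ A.erase a, log (1 / chordalDist w b) ≤ ∑ _b ∈ A.erase a, K := by
          refine Finset.sum_le_sum fun b hb ↦ ?_
          have hb' := Finset.mem_of_mem_erase hb
          have := hK w a ha b hb' (Finset.ne_of_mem_erase hb).symm
          rwa [min_eq_right (hmax b hb')] at this
      _ ≤ A.card * K := by
          rw [Finset.sum_const, nsmul_eq_mul]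
          gcongr
          exact Finset.erase_subset _ _
  have h2 : s * log (1 / chordalDist w a) ≤ log (targetWeight A s w) := by
    have hp := chordalDist_pos (hw a ha)
    rw [one_div, Real.log_inv, mul_neg, ← neg_mul, ← Real.log_rpow hp]
    refine Real.log_le_log (by positivity) ?_
    have := Finset.single_le_sum (f := fun a ↦ chordalDist w a ^ (-s))
      (fun a _ ↦ Real.rpow_nonneg (chordalDist_nonneg w a) _) ha
    simp only [targetWeight] at this ⊢
    linarith
  rw [← Finset.add_sum_erase A _ ha, mul_add]
  gcongr

lemma continuous_chordalDist_uncurry : Continuous fun p : ℂ × ℂ ↦ chordalDist p.1 p.2 := by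
  simp only [chordalDist_coe]
  refine Continuous.div (by fun_prop) (by fun_prop) fun p ↦ by positivity

lemma continuous_chordalDist (a : OnePoint ℂ) : Continuous fun w ↦ chordalDist w a := by
  induction a using OnePoint.rec with
  | infty =>
    simp only [chordalDist_infty]
    refine Continuous.div (by fun_prop) (by fun_prop) fun p ↦ by positivity
  | coe b =>
    simp only [chordalDist_coe]
    refine Continuous.div (by fun_prop) (by fun_prop) fun p ↦ by positivity

lemma measurable_targetWeight (A : Finset (OnePoint ℂ)) (s : ℝ) :
    Measurable (targetWeight A s) := by
  unfold targetWeight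
  exact measurable_const.add (Finset.measurable_sum _ fun a _ ↦
    (continuous_chordalDist a).measurable.pow_const _)

/-! ### Integrals over the sphere -/

/-- The density of the normalised spherical area with respect to Lebesgue measure. -/
noncomputable def sphereDensity (b : ℂ) : ℝ := 1 / (π * (1 + ‖b‖ ^ 2) ^ 2)

lemma sphereDensity_pos (b : ℂ) : 0 < sphereDensity b := by
  unfold sphereDensity; positivity

@[fun_prop]
lemma continuous_sphereDensity : Continuous sphereDensity := by
  unfold sphereDensity
  exact Continuous.div (by fun_prop) (by fun_prop) fun b ↦ by positivity

lemma sphereDensity_le (b : ℂ) : sphereDensity b ≤ 4 * (1 + ‖b‖) ^ (-4 : ℝ) := by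
  have h : (1 + ‖b‖) ^ 2 ≤ 2 * (1 + ‖b‖ ^ 2) := by nlinarith [sq_nonneg (1 - ‖b‖)]
  have h2 : (1 + ‖b‖) ^ 4 ≤ 4 * (1 + ‖b‖ ^ 2) ^ 2 := by
    calc (1 + ‖b‖) ^ 4 = ((1 + ‖b‖) ^ 2) ^ 2 := by ring
      _ ≤ (2 * (1 + ‖b‖ ^ 2)) ^ 2 := by gcongr
      _ = _ := by ring
  rw [Real.rpow_neg (by positivity), ← div_eq_mul_inv, sphereDensity]
  have h3 : (1 + ‖b‖) ^ (4 : ℝ) = (1 + ‖b‖) ^ 4 := by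
    rw [← Real.rpow_natCast]; norm_num
  rw [h3, div_le_div_iff₀ (by positivity) (by positivity)]
  nlinarith [Real.pi_gt_three, show 0 ≤ (1 + ‖b‖ ^ 2) ^ 2 by positivity]

lemma integrable_sphereDensity : Integrable sphereDensity := by
  refine ((integrable_one_add_norm (E := ℂ) (r := 4) (by simp; norm_num)).const_mul 4).mono'
    continuous_sphereDensity.aestronglyMeasurable (ae_of_all _ fun b ↦ ?_)
  rw [Real.norm_of_nonneg (sphereDensity_pos b).le]
  exact sphereDensity_le b

lemma integral_sphereDensity : ∫ b, sphereDensity b = 1 := by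
  have h := integral_fun_norm_addHaar (volume : Measure ℂ) (fun y : ℝ ↦ 1 / (π * (1 + y ^ 2) ^ 2))
  have hb : (volume : Measure ℂ).real (Metric.ball 0 1) = π := by
    simp [Measure.real, Complex.volume_ball]
  have hd : ∀ y ∈ Set.Ici (0 : ℝ), HasDerivAt (fun y : ℝ ↦ -(1 / (2 * π)) * (1 + y ^ 2)⁻¹)
      (y ^ (2 - 1) • (1 / (π * (1 + y ^ 2) ^ 2))) y := fun y _ ↦ by
    have h1 : HasDerivAt (fun y : ℝ ↦ 1 + y ^ 2) (2 * y) y := by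
      simpa using (hasDerivAt_pow 2 y).const_add 1
    have h2 := (h1.inv (by positivity)).const_mul (-(1 / (2 * π)))
    refine h2.congr_deriv ?_
    simp only [smul_eq_mul, Nat.add_one_sub_one, pow_one]
    field_simp
  have hl : Tendsto (fun y : ℝ ↦ -(1 / (2 * π)) * (1 + y ^ 2)⁻¹) atTop
      (𝓝 (-(1 / (2 * π)) * 0)) := by
    refine Tendsto.const_mul _ (tendsto_inv_atTop_zero.comp ?_)
    exact tendsto_atTop_add_const_left _ _ (tendsto_pow_atTop two_ne_zero)
  have hi := integral_Ioi_of_hasDerivAt_of_nonneg' hd (fun y hy ↦ by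
    have : (0 : ℝ) < y := hy
    positivity) hl
  rw [Complex.finrank_real_complex] at h
  change ∫ b : ℂ, 1 / (π * (1 + ‖b‖ ^ 2) ^ 2) = 1
  rw [h, hi, hb]
  simp

/-- The singular part of the majorant of `[w, b]⁻ˢ`. -/
noncomputable def nearKernel (s : ℝ) : ℂ → ℝ :=
  Set.indicator (Metric.ball 0 1) fun x ↦ ‖x‖ ^ (-s)

lemma nearKernel_nonneg (s : ℝ) (x : ℂ) : 0 ≤ nearKernel s x :=
  Set.indicator_nonneg (fun _ _ ↦ by positivity) _

lemma integrable_nearKernel {s : ℝ} (hs : s < 2) : Integrable (nearKernel s) := by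
  rw [nearKernel, integrable_indicator_iff measurableSet_ball]
  refine integrableOn_ball_of_norm_le_rpow (C := 1) (α := s) (by simp) (by simpa using hs)
    (ae_of_all _ fun x ↦ ?_) (by fun_prop : Measurable fun x : ℂ ↦ ‖x‖ ^ (-s)).aestronglyMeasurable
  rw [one_mul, Real.norm_of_nonneg (by positivity)]

/-- A majorant of `[w, b]⁻ˢ` that separates the singularity at `b = w` from the growth at infinity.
The two uses differ in how `M` depends on `w` and `b`. -/
lemma chordalDist_rpow_le {w b : ℂ} {s M : ℝ} (hs : 0 < s) (hM : 0 ≤ M)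
    (h : √(1 + ‖w‖ ^ 2) * √(1 + ‖b‖ ^ 2) ≤ M * max 1 ‖w - b‖) :
    chordalDist w b ^ (-s) ≤ M ^ s * (nearKernel s (b - w) + 1) := by
  rcases eq_or_ne w b with rfl | hwb
  · rw [chordalDist_coe, sub_self, norm_zero, zero_div, Real.zero_rpow (by linarith)]
    have := nearKernel_nonneg s 0
    positivity
  have hd : 0 < ‖w - b‖ := norm_pos_iff.2 (sub_ne_zero.2 hwb)
  rw [chordalDist_coe, Real.rpow_neg (by positivity), ← Real.inv_rpow (by positivity), inv_div]
  rcases lt_or_ge ‖w - b‖ 1 with h1 | h1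
  · rw [max_eq_left h1.le] at h
    have hk : nearKernel s (b - w) = ‖w - b‖ ^ (-s) := by
      rw [nearKernel, Set.indicator_of_mem (by simpa [norm_sub_rev] using h1), norm_sub_rev]
    rw [hk, Real.div_rpow (by positivity) hd.le, div_eq_mul_inv, ← Real.rpow_neg hd.le]
    gcongr
    · linarith
    · linarith
  · rw [max_eq_right h1] at h
    have hk := nearKernel_nonneg s (b - w)
    calc (√(1 + ‖w‖ ^ 2) * √(1 + ‖b‖ ^ 2) / ‖w - b‖) ^ s ≤ M ^ s := by
          gcongr
          rwa [div_le_iff₀ hd]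
      _ ≤ M ^ s * (nearKernel s (b - w) + 1) := le_mul_of_one_le_right (by positivity) (by linarith)

lemma sqrt_one_add_norm_sq_le_one_add (b : ℂ) : √(1 + ‖b‖ ^ 2) ≤ 1 + ‖b‖ :=
  sqrt_one_add_norm_sq_le b

lemma integrable_one_add_norm_rpow {t : ℝ} (ht : 2 < t) :
    Integrable fun b : ℂ ↦ (1 + ‖b‖) ^ (-t) :=
  integrable_one_add_norm (by simpa using ht)

lemma aestronglyMeasurable_chordalDist_rpow (a : OnePoint ℂ) (s : ℝ) :
    AEStronglyMeasurable (fun b : ℂ ↦ chordalDist b a ^ (-s) * sphereDensity b) :=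
  (((continuous_chordalDist a).measurable.pow_const _).mul
    continuous_sphereDensity.measurable).aestronglyMeasurable

/-- The powers `[b, a]⁻ˢ` with `s < 2` are integrable for the spherical area. -/
lemma integrable_chordalDist_rpow (a : OnePoint ℂ) {s : ℝ} (hs : 0 < s) (hs2 : s < 2) :
    Integrable fun b : ℂ ↦ chordalDist b a ^ (-s) * sphereDensity b := by
  have hu : ∀ b : ℂ, (1 + ‖b‖) ^ s * (1 + ‖b‖) ^ (-4 : ℝ) = (1 + ‖b‖) ^ (-(4 - s)) := fun b ↦ by
    rw [← Real.rpow_add (by positivity)]; congr 1; ring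
  have hint := integrable_one_add_norm_rpow (t := 4 - s) (by linarith)
  induction a using OnePoint.rec with
  | infty =>
    refine (hint.const_mul 4).mono' (aestronglyMeasurable_chordalDist_rpow _ _)
      (ae_of_all _ fun b ↦ ?_)
    have hd := sphereDensity_pos b
    rw [chordalDist_infty, Real.norm_of_nonneg (by positivity), Real.rpow_neg (by positivity),
      ← Real.inv_rpow (by positivity), one_div, inv_inv, ← hu]
    calc √(1 + ‖b‖ ^ 2) ^ s * sphereDensity b
        ≤ (1 + ‖b‖) ^ s * (4 * (1 + ‖b‖) ^ (-4 : ℝ)) := by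
          gcongr
          · exact sqrt_one_add_norm_sq_le_one_add b
          · exact sphereDensity_le b
      _ = _ := by ring
  | coe w =>
    refine ((((integrable_nearKernel hs2).comp_sub_right w).add hint).const_mul
      (√(1 + ‖w‖ ^ 2) ^ s * 4)).mono' (aestronglyMeasurable_chordalDist_rpow _ _)
      (ae_of_all _ fun b ↦ ?_)
    have hd := sphereDensity_pos b
    have hk := nearKernel_nonneg s (b - w)
    rw [Real.norm_of_nonneg (mul_nonneg (Real.rpow_nonneg (chordalDist_nonneg _ _) _) hd.le),
      chordalDist_comm]
    have h1 : chordalDist w b ^ (-s) ≤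
        (√(1 + ‖w‖ ^ 2) * (1 + ‖b‖)) ^ s * (nearKernel s (b - w) + 1) := by
      refine chordalDist_rpow_le hs (by positivity) ?_
      calc √(1 + ‖w‖ ^ 2) * √(1 + ‖b‖ ^ 2) ≤ √(1 + ‖w‖ ^ 2) * (1 + ‖b‖) := by
            gcongr
            exact sqrt_one_add_norm_sq_le_one_add b
        _ ≤ _ := le_mul_of_one_le_right (by positivity) (le_max_left _ _)
    rw [Real.mul_rpow (by positivity) (by positivity)] at h1
    have h2 : (1 + ‖b‖) ^ (-(4 - s)) ≤ 1 :=
      Real.rpow_le_one_of_one_le_of_nonpos (by linarith [norm_nonneg b]) (by linarith)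
    calc chordalDist w b ^ (-s) * sphereDensity b
        ≤ (√(1 + ‖w‖ ^ 2) ^ s * (1 + ‖b‖) ^ s * (nearKernel s (b - w) + 1)) *
          (4 * (1 + ‖b‖) ^ (-4 : ℝ)) := by
          gcongr
          exact sphereDensity_le b
      _ = √(1 + ‖w‖ ^ 2) ^ s * 4 *
          ((1 + ‖b‖) ^ (-(4 - s)) * nearKernel s (b - w) + (1 + ‖b‖) ^ (-(4 - s))) := by
          rw [← hu]; ring
      _ ≤ √(1 + ‖w‖ ^ 2) ^ s * 4 * (nearKernel s (b - w) + (1 + ‖b‖) ^ (-(4 - s))) := by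
          gcongr
          exact mul_le_of_le_one_left hk h2

lemma log_one_div_chordalDist_le (w : ℂ) (a : OnePoint ℂ) {t : ℝ} (ht : 0 < t) :
    log (1 / chordalDist w a) ≤ chordalDist w a ^ (-t) / t := by
  have h := chordalDist_nonneg w a
  have := Real.log_le_rpow_div (x := 1 / chordalDist w a) (by positivity) ht
  rw [one_div] at this ⊢
  rwa [Real.inv_rpow h, ← Real.rpow_neg h] at this

lemma measurable_log_chordalDist_left (x : OnePoint ℂ) :
    Measurable fun b : ℂ ↦ log (1 / chordalDist b x) := by
  have := (continuous_chordalDist x).measurable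
  fun_prop

lemma measurable_log_chordalDist (w : ℂ) :
    Measurable fun b : ℂ ↦ log (1 / chordalDist w b) := by
  simp_rw [chordalDist_comm w]
  exact measurable_log_chordalDist_left w

lemma ae_coe_ne (x : OnePoint ℂ) : ∀ᵐ b : ℂ, (b : OnePoint ℂ) ≠ x := by
  induction x using OnePoint.rec with
  | infty => simp
  | coe c =>
    filter_upwards [compl_mem_ae_iff.2 (measure_singleton c)] with b hb h
    exact hb (OnePoint.coe_injective h)

/-- The spherical mean of `log (1 / [w, b])` over `b` is bounded independently of `w`. -/
lemma exists_integral_log_one_div_chordalDist_le :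
    ∃ C : ℝ, ∀ w : ℂ, Integrable (fun b : ℂ ↦ log (1 / chordalDist w b) * sphereDensity b) ∧
      ∫ b : ℂ, log (1 / chordalDist w b) * sphereDensity b ≤ C := by
  have hs : (0 : ℝ) < 1 / 2 := by norm_num
  have hk := integrable_nearKernel (s := 1 / 2) (by norm_num)
  have hint := integrable_one_add_norm_rpow (t := 3) (by norm_num)
  let g : ℂ → ℂ → ℝ := fun w b ↦
    8 * 2 ^ (1 / 2 : ℝ) * (nearKernel (1 / 2) (b - w) + (1 + ‖b‖) ^ (-(3 : ℝ)))
  have hg : ∀ w, Integrable (g w) := fun w ↦ ((hk.comp_sub_right w).add hint).const_mul _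
  have hle : ∀ w b : ℂ, log (1 / chordalDist w b) * sphereDensity b ≤ g w b := fun w b ↦ by
    have hd := sphereDensity_pos b
    have hkn := nearKernel_nonneg (1 / 2) (b - w)
    have h1 : chordalDist w b ^ (-(1 / 2 : ℝ)) ≤
        (2 * (1 + ‖b‖) ^ 2) ^ (1 / 2 : ℝ) * (nearKernel (1 / 2) (b - w) + 1) := by
      refine chordalDist_rpow_le hs (by positivity) ?_
      have h2 : √(1 + ‖w‖ ^ 2) ≤ (2 * (1 + ‖b‖)) * max 1 ‖w - b‖ := by
        have h3 : ‖w‖ ≤ ‖b‖ + ‖w - b‖ := by simpa [add_comm] using norm_add_le (w - b) b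
        have h4 := le_max_left 1 ‖w - b‖
        have h5 := le_max_right 1 ‖w - b‖
        nlinarith [sqrt_one_add_norm_sq_le_one_add w, norm_nonneg b, norm_nonneg (w - b)]
      calc √(1 + ‖w‖ ^ 2) * √(1 + ‖b‖ ^ 2)
          ≤ ((2 * (1 + ‖b‖)) * max 1 ‖w - b‖) * (1 + ‖b‖) := by
            gcongr
            exact sqrt_one_add_norm_sq_le_one_add b
        _ = _ := by ring
    have h6 : ((1 + ‖b‖) ^ 2) ^ (1 / 2 : ℝ) = 1 + ‖b‖ := by
      rw [← Real.sqrt_eq_rpow, Real.sqrt_sq (by positivity)]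
    have h7 : (1 + ‖b‖) * (1 + ‖b‖) ^ (-4 : ℝ) = (1 + ‖b‖) ^ (-(3 : ℝ)) := by
      nth_rw 1 [← Real.rpow_one (1 + ‖b‖)]
      rw [← Real.rpow_add (by positivity)]; norm_num
    have h8 : (1 + ‖b‖) ^ (-(3 : ℝ)) ≤ 1 :=
      Real.rpow_le_one_of_one_le_of_nonpos (by linarith [norm_nonneg b]) (by norm_num)
    rw [Real.mul_rpow (by norm_num) (by positivity), h6] at h1
    calc log (1 / chordalDist w b) * sphereDensity b
        ≤ (2 * (2 ^ (1 / 2 : ℝ) * (1 + ‖b‖) * (nearKernel (1 / 2) (b - w) + 1))) *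
          (4 * (1 + ‖b‖) ^ (-4 : ℝ)) := by
          gcongr
          · refine (log_one_div_chordalDist_le w b hs).trans ?_
            rw [div_le_iff₀ hs]
            linarith
          · exact sphereDensity_le b
      _ = 8 * 2 ^ (1 / 2 : ℝ) * ((1 + ‖b‖) ^ (-(3 : ℝ)) * nearKernel (1 / 2) (b - w) +
          (1 + ‖b‖) ^ (-(3 : ℝ))) := by
          rw [← h7]; ring
      _ ≤ 8 * 2 ^ (1 / 2 : ℝ) * (nearKernel (1 / 2) (b - w) + (1 + ‖b‖) ^ (-(3 : ℝ))) := by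
          gcongr
          exact mul_le_of_le_one_left hkn h8
  have hi : ∀ w : ℂ, Integrable (fun b : ℂ ↦ log (1 / chordalDist w b) * sphereDensity b) :=
    fun w ↦ (hg w).mono' ((measurable_log_chordalDist w).mul
      continuous_sphereDensity.measurable).aestronglyMeasurable (ae_of_all _ fun b ↦ by
        rw [Real.norm_of_nonneg (mul_nonneg (log_one_div_chordalDist_nonneg _ _)
          (sphereDensity_pos b).le)]
        exact hle w b)
  refine ⟨8 * 2 ^ (1 / 2 : ℝ) * ((∫ b, nearKernel (1 / 2) b) + ∫ b : ℂ, (1 + ‖b‖) ^ (-(3 : ℝ))),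
    fun w ↦ ⟨hi w, (integral_mono (hi w) (hg w) (hle w)).trans_eq ?_⟩⟩
  simp only [g]
  rw [integral_const_mul, integral_add (hk.comp_sub_right w) hint,
    integral_sub_right_eq_self (nearKernel (1 / 2)) w]

/-- The powers `[b, a]⁻ˢ` with `s < 2` stay integrable after multiplication by a logarithmic
singularity, even at the same point. -/
lemma integrable_chordalDist_rpow_mul_log (a x : OnePoint ℂ) {s : ℝ} (hs : 0 < s) (hs2 : s < 2) :
    Integrable fun b : ℂ ↦ chordalDist b a ^ (-s) * log (1 / chordalDist b x) * sphereDensity b := by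
  set t : ℝ := (2 - s) / 2 with ht
  have ht0 : 0 < t := by rw [ht]; linarith
  have h1 := integrable_chordalDist_rpow a (s := s + t) (by linarith) (by rw [ht]; linarith)
  have h2 := integrable_chordalDist_rpow x (s := s + t) (by linarith) (by rw [ht]; linarith)
  refine ((h1.add h2).const_mul (1 / t)).mono' ((((continuous_chordalDist a).measurable.pow_const
    _).mul (measurable_log_chordalDist_left x)).mul
    continuous_sphereDensity.measurable).aestronglyMeasurable ?_
  filter_upwards [ae_coe_ne a, ae_coe_ne x] with b hba hbx
  have ha := chordalDist_pos hba
  have hx := chordalDist_pos hbx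
  have hd := sphereDensity_pos b
  have hl := log_one_div_chordalDist_nonneg b x
  rw [Real.norm_of_nonneg (by positivity)]
  have hlog := log_one_div_chordalDist_le b x ht0
  -- Young's inequality in the crude form `u⁻ˢ v⁻ᵗ ≤ u⁻ˢ⁻ᵗ + v⁻ˢ⁻ᵗ`
  have hxy : chordalDist b a ^ (-s) * chordalDist b x ^ (-t) ≤
      chordalDist b a ^ (-(s + t)) + chordalDist b x ^ (-(s + t)) := by
    rw [neg_add, Real.rpow_add ha, Real.rpow_add hx]
    rcases le_total (chordalDist b a) (chordalDist b x) with h | h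
    · have h3 := Real.rpow_le_rpow_of_nonpos ha h (neg_nonpos.2 ht0.le)
      have h4 : 0 ≤ chordalDist b x ^ (-s) * chordalDist b x ^ (-t) := by positivity
      have h5 := mul_le_mul_of_nonneg_left h3 (Real.rpow_nonneg ha.le (-s))
      linarith
    · have h3 := Real.rpow_le_rpow_of_nonpos hx h (neg_nonpos.2 hs.le)
      have h4 : 0 ≤ chordalDist b a ^ (-s) * chordalDist b a ^ (-t) := by positivity
      have h5 := mul_le_mul_of_nonneg_right h3 (Real.rpow_nonneg hx.le (-t))
      linarith
  calc chordalDist b a ^ (-s) * log (1 / chordalDist b x) * sphereDensity b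
      ≤ chordalDist b a ^ (-s) * (chordalDist b x ^ (-t) / t) * sphereDensity b := by gcongr
    _ = 1 / t * ((chordalDist b a ^ (-s) * chordalDist b x ^ (-t)) * sphereDensity b) := by ring
    _ ≤ 1 / t * ((chordalDist b a ^ (-(s + t)) + chordalDist b x ^ (-(s + t))) *
        sphereDensity b) := by gcongr
    _ = _ := by simp only [Pi.add_apply]; ring

lemma integrable_log_one_div_chordalDist (x : OnePoint ℂ) :
    Integrable fun b : ℂ ↦ log (1 / chordalDist b x) * sphereDensity b := by
  refine (integrable_chordalDist_rpow x (s := 1) one_pos (by norm_num)).mono'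
    ((measurable_log_chordalDist_left x).mul
      continuous_sphereDensity.measurable).aestronglyMeasurable (ae_of_all _ fun b ↦ ?_)
  have hd := sphereDensity_pos b
  rw [Real.norm_of_nonneg (mul_nonneg (log_one_div_chordalDist_nonneg b x) hd.le)]
  gcongr
  simpa using log_one_div_chordalDist_le b x one_pos

lemma integrable_targetWeight (A : Finset (OnePoint ℂ)) {s : ℝ} (hs : 0 < s) (hs2 : s < 2) :
    Integrable fun b : ℂ ↦ targetWeight A s b * sphereDensity b := by
  simp only [targetWeight, add_mul, one_mul, Finset.sum_mul]
  exact integrable_sphereDensity.add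
    (integrable_finsetSum _ fun a _ ↦ integrable_chordalDist_rpow a hs hs2)

lemma integrable_targetWeight_mul_log (A : Finset (OnePoint ℂ)) (x : OnePoint ℂ) {s : ℝ}
    (hs : 0 < s) (hs2 : s < 2) :
    Integrable fun b : ℂ ↦
      targetWeight A s b * log (1 / chordalDist b x) * sphereDensity b := by
  simp only [targetWeight, add_mul, one_mul, Finset.sum_mul]
  exact (integrable_log_one_div_chordalDist x).add
    (integrable_finsetSum _ fun a _ ↦ integrable_chordalDist_rpow_mul_log a x hs hs2)

/-! ### The first main theorem -/

variable {f : ℂ → ℂ}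

/-- A nonconstant meromorphic function takes every value with finite multiplicity. -/
lemma meromorphicOrderAt_sub_const_ne_top (hf : Meromorphic f)
    (hconst : ¬ ∃ c : ℂ, f =ᶠ[codiscrete ℂ] fun _ ↦ c) (a z : ℂ) :
    meromorphicOrderAt (fun w ↦ f w - a) z ≠ ⊤ := by
  intro h
  have hg : Meromorphic fun w ↦ f w - a := hf.fun_sub (Meromorphic.const a)
  have hall : ∀ u, meromorphicOrderAt (fun w ↦ f w - a) u = ⊤ := by
    by_contra! hne
    exact hg.exists_meromorphicOrderAt_ne_top_iff_forall.1 hne z h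
  refine hconst ⟨a, ?_⟩
  rw [EventuallyEq, Filter.Eventually, mem_codiscrete]
  intro u
  rw [disjoint_principal_right, compl_compl]
  filter_upwards [meromorphicOrderAt_eq_top_iff.1 (hall u)] with w hw
  exact sub_eq_zero.1 hw

lemma eventually_codiscrete_ne (hf : Meromorphic f)
    (hconst : ¬ ∃ c : ℂ, f =ᶠ[codiscrete ℂ] fun _ ↦ c) (a : OnePoint ℂ) :
    ∀ᶠ z in codiscrete ℂ, (f z : OnePoint ℂ) ≠ a := by
  induction a using OnePoint.rec with
  | infty => simp
  | coe a =>
    have hg : MeromorphicOn (fun w ↦ f w - a) Set.univ :=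
      fun z _ ↦ (hf z).fun_sub (MeromorphicAt.const a z)
    filter_upwards [hg.eventually_codiscreteWithin_apply_ne_zero fun z _ ↦
      meromorphicOrderAt_sub_const_ne_top hf hconst a z] with z hz h
    exact hz (sub_eq_zero.2 (OnePoint.coe_injective h))

/-- The characteristic in the form `N(r, ∞) + m(r, ∞)`. It differs from `characteristic f` by a
bounded function. -/
noncomputable def sphericalCharacteristic (f : ℂ → ℂ) (r : ℝ) : ℝ :=
  ValueDistribution.logCounting f ⊤ r + proximity f OnePoint.infty r

/-- The constant term of the first main theorem for the value `a`. -/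
noncomputable def jensenConstant (f : ℂ → ℂ) (a : ℂ) : ℝ :=
  log √(1 + ‖a‖ ^ 2) - log ‖meromorphicTrailingCoeffAt (fun w ↦ f w - a) 0‖

lemma proximity_infty (r : ℝ) :
    proximity f OnePoint.infty r = circleAverage (fun z ↦ log √(1 + ‖f z‖ ^ 2)) 0 r := by
  simp only [proximity, log_one_div_chordalDist_infty]

lemma proximity_nonneg (a : OnePoint ℂ) (r : ℝ) : 0 ≤ proximity f a r :=
  circleAverage_nonneg_of_nonneg fun z _ ↦ log_one_div_chordalDist_nonneg (f z) a

lemma log_sqrt_one_add_sq_le {x : ℝ} (hx : 0 ≤ x) : log √(1 + x ^ 2) ≤ log⁺ x + log 2 := by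
  have h1 : √(1 + x ^ 2) ≤ 1 + x := by
    rw [Real.sqrt_le_left (by positivity)]
    nlinarith
  calc log √(1 + x ^ 2) ≤ log (1 + x) := Real.log_le_log (by positivity) h1
    _ ≤ log⁺ (1 + x) := le_max_right _ _
    _ ≤ _ := by simpa [add_comm, add_left_comm] using Real.posLog_add (x := 1) (y := x)

lemma circleIntegrable_log_sqrt (hf : Meromorphic f) (r : ℝ) :
    CircleIntegrable (fun z ↦ log √(1 + ‖f z‖ ^ 2)) 0 r := by
  have h := hf.meromorphicOn.circleIntegrable_posLog_norm (c := 0) (R := r)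
  have h2 := h.add (circleIntegrable_const (log 2) 0 r)
  have hm := hf.measurable
  refine IntervalIntegrable.mono_fun h2 ?_ (ae_of_all _ fun θ ↦ ?_)
  · have : Measurable fun θ ↦ log √(1 + ‖f (circleMap 0 r θ)‖ ^ 2) := by
      have := (continuous_circleMap 0 r).measurable
      fun_prop
    exact this.aestronglyMeasurable
  · change ‖log √(1 + ‖f (circleMap 0 r θ)‖ ^ 2)‖ ≤ ‖log⁺ ‖f (circleMap 0 r θ)‖ + log 2‖
    rw [Real.norm_of_nonneg (Real.log_nonneg (one_le_sqrt_one_add_norm_sq _))]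
    exact (log_sqrt_one_add_sq_le (norm_nonneg _)).trans (le_abs_self _)

lemma circleIntegrable_log_norm_sub (hf : Meromorphic f) (a : ℂ) (r : ℝ) :
    CircleIntegrable (fun z ↦ log ‖f z - a‖) 0 r :=
  (hf.fun_sub (Meromorphic.const a)).meromorphicOn.circleIntegrable_log_norm

lemma circleIntegrable_log_one_div_chordalDist (hf : Meromorphic f)
    (hconst : ¬ ∃ c : ℂ, f =ᶠ[codiscrete ℂ] fun _ ↦ c) (a : OnePoint ℂ) {r : ℝ} :
    CircleIntegrable (fun z ↦ log (1 / chordalDist (f z) a)) 0 r := by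
  induction a using OnePoint.rec with
  | infty =>
    simp only [log_one_div_chordalDist_infty]
    exact circleIntegrable_log_sqrt hf r
  | coe a =>
    refine CircleIntegrable.congr_codiscreteWithin ?_ (((circleIntegrable_log_sqrt hf r).add
      (circleIntegrable_const (log √(1 + ‖a‖ ^ 2)) 0 r)).sub
      (circleIntegrable_log_norm_sub hf a r))
    filter_upwards [(eventually_codiscrete_ne hf hconst a).filter_mono
      (codiscreteWithin_mono (Set.subset_univ _))] with z hz
    have : f z ≠ a := fun h ↦ hz (by rw [h])
    simp [← log_one_div_chordalDist_coe this]

lemma proximity_coe (hf : Meromorphic f)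
    (hconst : ¬ ∃ c : ℂ, f =ᶠ[codiscrete ℂ] fun _ ↦ c) (a : ℂ) {r : ℝ} (hr : r ≠ 0) :
    proximity f a r = proximity f OnePoint.infty r + log √(1 + ‖a‖ ^ 2) -
      circleAverage (fun z ↦ log ‖f z - a‖) 0 r := by
  have h1 := circleIntegrable_log_sqrt hf r
  have h2 := circleIntegrable_const (log √(1 + ‖a‖ ^ 2)) 0 r
  have h3 := circleIntegrable_log_norm_sub hf a r
  rw [proximity_infty, ← circleAverage_const (log √(1 + ‖a‖ ^ 2)) 0 r, ← circleAverage_add h1 h2,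
    ← circleAverage_sub (h1.add h2) h3, proximity]
  refine circleAverage_congr_codiscreteWithin ?_ hr
  filter_upwards [(eventually_codiscrete_ne hf hconst a).filter_mono
    (codiscreteWithin_mono (Set.subset_univ _))] with z hz
  have : f z ≠ a := fun h ↦ hz (by rw [h])
  simp [← log_one_div_chordalDist_coe this]

/-- The first main theorem, from Jensen's formula for `f - a`. -/
lemma logCounting_add_proximity (hf : Meromorphic f)
    (hconst : ¬ ∃ c : ℂ, f =ᶠ[codiscrete ℂ] fun _ ↦ c) (a : ℂ) {r : ℝ} (hr : r ≠ 0) :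
    ValueDistribution.logCounting f (a : WithTop ℂ) r + proximity f a r =
      sphericalCharacteristic f r + jensenConstant f a := by
  have h : ValueDistribution.logCounting f (a : WithTop ℂ) r - ValueDistribution.logCounting f ⊤ r =
      circleAverage (fun z ↦ log ‖f z - a‖) 0 r -
        log ‖meromorphicTrailingCoeffAt (fun w ↦ f w - a) 0‖ := by
    rw [ValueDistribution.logCounting_coe_eq_logCounting_sub_const_zero,
      ← ValueDistribution.logCounting_sub_const (a₀ := a) hf]
    exact ValueDistribution.logCounting_zero_sub_logCounting_top_eq_circleAverage_sub_const
      (hf.fun_sub (Meromorphic.const a)) hr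
  rw [proximity_coe hf hconst a hr, sphericalCharacteristic, jensenConstant]
  linarith

/-- The proximity function is bounded by the characteristic. -/
lemma exists_proximity_le (hf : Meromorphic f)
    (hconst : ¬ ∃ c : ℂ, f =ᶠ[codiscrete ℂ] fun _ ↦ c) (a : OnePoint ℂ) :
    ∃ C : ℝ, ∀ r : ℝ, 1 ≤ r → proximity f a r ≤ sphericalCharacteristic f r + C := by
  induction a using OnePoint.rec with
  | infty =>
    refine ⟨0, fun r hr ↦ ?_⟩
    have := ValueDistribution.logCounting_nonneg (f := f) (e := ⊤) hr
    rw [sphericalCharacteristic]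
    linarith
  | coe a =>
    refine ⟨jensenConstant f a, fun r hr ↦ ?_⟩
    have := ValueDistribution.logCounting_nonneg (f := f) (e := (a : WithTop ℂ)) hr
    rw [← logCounting_add_proximity hf hconst a (by linarith)]
    linarith

/-- The constant in the first main theorem has only a logarithmic singularity, at the value
`f(0)`. -/
lemma exists_jensenConstant_eq (hf : Meromorphic f) :
    ∃ (x : OnePoint ℂ) (k : ℝ), ∀ a : ℂ, (a : OnePoint ℂ) ≠ x →
      jensenConstant f a = log (1 / chordalDist a x) + k := by
  rcases lt_or_ge (meromorphicOrderAt f 0) 0 with h | h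
  · refine ⟨OnePoint.infty, -log ‖meromorphicTrailingCoeffAt f 0‖, fun a _ ↦ ?_⟩
    rw [jensenConstant, log_one_div_chordalDist_infty,
      (MeromorphicAt.const a 0).meromorphicTrailingCoeffAt_fun_sub_eq_left_of_lt, sub_eq_add_neg]
    rw [meromorphicOrderAt_const]
    split_ifs with ha
    · exact h.trans_le le_top
    · exact h
  · obtain ⟨L, hL⟩ := tendsto_nhds_of_meromorphicOrderAt_nonneg (hf 0) h
    refine ⟨L, -log √(1 + ‖L‖ ^ 2), fun a ha ↦ ?_⟩
    have hne : a ≠ L := fun h ↦ ha (by rw [h])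
    have ht : meromorphicTrailingCoeffAt (fun w ↦ f w - a) 0 = L - a := by
      have hlim : Tendsto (fun w ↦ f w - a) (𝓝[≠] 0) (𝓝 (L - a)) := hL.sub_const a
      have hm : MeromorphicAt (fun w ↦ f w - a) 0 := (hf 0).fun_sub (MeromorphicAt.const a 0)
      have h0 : meromorphicOrderAt (fun w ↦ f w - a) 0 = 0 :=
        (tendsto_ne_zero_iff_meromorphicOrderAt_eq_zero hm).1
          ⟨L - a, sub_ne_zero.2 hne.symm, hlim⟩
      have := hm.tendsto_nhds_meromorphicTrailingCoeffAt
      refine tendsto_nhds_unique (this.congr' ?_) hlim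
      rw [h0]
      exact Eventually.of_forall fun w ↦ by simp
    rw [jensenConstant, ht, log_one_div_chordalDist_coe hne, norm_sub_rev]
    ring

lemma integrable_jensenConstant (hf : Meromorphic f) :
    Integrable fun a : ℂ ↦ jensenConstant f a * sphereDensity a := by
  obtain ⟨x, k, hx⟩ := exists_jensenConstant_eq hf
  refine ((integrable_log_one_div_chordalDist x).add
    (integrable_sphereDensity.const_mul k)).congr ?_
  filter_upwards [ae_coe_ne x] with a ha
  rw [Pi.add_apply, hx a ha]
  ring

lemma integrable_proximity_kernel (hf : Meromorphic f) (r : ℝ) :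
    Integrable (fun p : ℂ × ℝ ↦
      log (1 / chordalDist (f (circleMap 0 r p.2)) p.1) * sphereDensity p.1)
      ((volume : Measure ℂ).prod (volume.restrict (Set.Ioc 0 (2 * π)))) := by
  obtain ⟨C, hC⟩ := exists_integral_log_one_div_chordalDist_le
  have hm : Measurable fun p : ℂ × ℝ ↦
      log (1 / chordalDist (f (circleMap 0 r p.2)) p.1) * sphereDensity p.1 := by
    have h1 : Measurable fun p : ℂ × ℝ ↦ (f (circleMap 0 r p.2), p.1) :=
      (hf.measurable.comp ((continuous_circleMap 0 r).measurable.comp measurable_snd)).prodMk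
        measurable_fst
    have h2 := continuous_chordalDist_uncurry.measurable.comp h1
    exact (Real.measurable_log.comp (measurable_const.div h2)).mul
      (continuous_sphereDensity.measurable.comp measurable_fst)
  have hnorm : ∀ θ : ℝ, (∫ a : ℂ, ‖log (1 / chordalDist (f (circleMap 0 r θ)) a) *
      sphereDensity a‖) ≤ C := fun θ ↦ by
    refine le_of_eq_of_le (integral_congr_ae (ae_of_all _ fun a ↦ ?_)) (hC (f (circleMap 0 r θ))).2
    exact Real.norm_of_nonneg (mul_nonneg (log_one_div_chordalDist_nonneg _ _)
      (sphereDensity_pos a).le)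
  have hint : Integrable (fun θ : ℝ ↦ ∫ a : ℂ, ‖log (1 / chordalDist (f (circleMap 0 r θ)) a) *
      sphereDensity a‖) (volume.restrict (Set.Ioc 0 (2 * π))) := by
    refine Integrable.mono' (integrable_const C)
      hm.norm.stronglyMeasurable.integral_prod_left'.aestronglyMeasurable (ae_of_all _ fun θ ↦ ?_)
    rw [Real.norm_of_nonneg (integral_nonneg fun _ ↦ norm_nonneg _)]
    exact hnorm θ
  exact (integrable_prod_iff' hm.aestronglyMeasurable).2
    ⟨ae_of_all _ fun θ ↦ (hC (f (circleMap 0 r θ))).1, hint⟩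

lemma proximity_mul_sphereDensity (a : ℂ) (r : ℝ) :
    proximity f a r * sphereDensity a = (2 * π)⁻¹ * ∫ θ in Set.Ioc 0 (2 * π),
      log (1 / chordalDist (f (circleMap 0 r θ)) a) * sphereDensity a := by
  rw [integral_mul_const, proximity, circleAverage_def, smul_eq_mul,
    intervalIntegral.integral_of_le two_pi_pos.le, mul_assoc]

lemma integrable_proximity (hf : Meromorphic f) (r : ℝ) :
    Integrable fun a : ℂ ↦ proximity f a r * sphereDensity a := by
  simp_rw [proximity_mul_sphereDensity]
  exact (integrable_proximity_kernel hf r).integral_prod_left.const_mul _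

/-- The spherical mean of the proximity functions is bounded, by Fubini. -/
lemma exists_integral_proximity_le (hf : Meromorphic f) :
    ∃ C : ℝ, ∀ r : ℝ, ∫ a : ℂ, proximity f a r * sphereDensity a ≤ C := by
  obtain ⟨C, hC⟩ := exists_integral_log_one_div_chordalDist_le
  refine ⟨C, fun r ↦ ?_⟩
  simp_rw [proximity_mul_sphereDensity]
  have hk := integrable_proximity_kernel hf r
  rw [integral_const_mul, integral_integral_swap hk]
  have h : ∫ θ in Set.Ioc 0 (2 * π), (∫ a : ℂ, log (1 / chordalDist (f (circleMap 0 r θ)) a) *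
      sphereDensity a) ≤ ∫ _θ in Set.Ioc 0 (2 * π), C :=
    integral_mono hk.integral_prod_right (integrable_const C) fun θ ↦ (hC _).2
  have hc : ∫ _θ in Set.Ioc 0 (2 * π), C = 2 * π * C := by
    simp [Real.pi_pos.le]
  rw [hc] at h
  calc (2 * π)⁻¹ * _ ≤ (2 * π)⁻¹ * (2 * π * C) := by gcongr
    _ = C := by field_simp

lemma logCounting_mul_sphereDensity (hf : Meromorphic f)
    (hconst : ¬ ∃ c : ℂ, f =ᶠ[codiscrete ℂ] fun _ ↦ c) (a : ℂ) {r : ℝ} (hr : r ≠ 0) :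
    ValueDistribution.logCounting f (a : WithTop ℂ) r * sphereDensity a =
      sphericalCharacteristic f r * sphereDensity a + jensenConstant f a * sphereDensity a -
        proximity f a r * sphereDensity a := by
  rw [← add_mul, ← logCounting_add_proximity hf hconst a hr]
  ring

/-- The Ahlfors–Shimizu characteristic is `N(r, ∞) + m(r, ∞)` up to a bounded term. -/
lemma exists_abs_characteristic_sub_le (hf : Meromorphic f)
    (hconst : ¬ ∃ c : ℂ, f =ᶠ[codiscrete ℂ] fun _ ↦ c) :
    ∃ C : ℝ, ∀ r : ℝ, r ≠ 0 → |characteristic f r - sphericalCharacteristic f r| ≤ C := by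
  obtain ⟨C, hC⟩ := exists_integral_proximity_le hf
  refine ⟨|∫ a : ℂ, jensenConstant f a * sphereDensity a| + C, fun r hr ↦ ?_⟩
  have h1 : characteristic f r = sphericalCharacteristic f r +
      (∫ a : ℂ, jensenConstant f a * sphereDensity a) -
        ∫ a : ℂ, proximity f a r * sphereDensity a := by
    have h2 := integrable_sphereDensity.const_mul (sphericalCharacteristic f r)
    have h3 := integrable_jensenConstant hf
    have h4 := integrable_proximity hf r
    calc characteristic f r = ∫ a : ℂ, (sphericalCharacteristic f r * sphereDensity a +
          jensenConstant f a * sphereDensity a - proximity f a r * sphereDensity a) :=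
          integral_congr_ae (ae_of_all _ fun a ↦ logCounting_mul_sphereDensity hf hconst a hr)
      _ = _ := by
          have h23 : Integrable fun a : ℂ ↦ sphericalCharacteristic f r * sphereDensity a +
            jensenConstant f a * sphereDensity a := h2.add h3
          rw [integral_sub h23 h4, integral_add h2 h3, integral_const_mul,
            integral_sphereDensity, mul_one]
  have h5 : 0 ≤ ∫ a : ℂ, proximity f a r * sphereDensity a :=
    integral_nonneg fun a ↦ mul_nonneg (proximity_nonneg _ _) (sphereDensity_pos a).le
  have h6 := hC r
  rw [h1, abs_le]
  constructor <;> cases abs_cases (∫ a : ℂ, jensenConstant f a * sphereDensity a) <;> linarith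

/-- A weighted mean of the counting functions is controlled by the characteristic. -/
lemma exists_lintegral_logCounting_le (hf : Meromorphic f)
    (hconst : ¬ ∃ c : ℂ, f =ᶠ[codiscrete ℂ] fun _ ↦ c) (A : Finset (OnePoint ℂ)) {s : ℝ}
    (hs : 0 < s) (hs2 : s < 2) :
    ∃ C₁ C₂ : ℝ, 0 ≤ C₁ ∧ ∀ r : ℝ, 1 ≤ r →
      ∫⁻ a : ℂ, ENNReal.ofReal (ValueDistribution.logCounting f (a : WithTop ℂ) r *
        (targetWeight A s a * sphereDensity a)) ≤
          ENNReal.ofReal (C₁ * sphericalCharacteristic f r + C₂) := by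
  obtain ⟨x, k, hx⟩ := exists_jensenConstant_eq hf
  have hp : ∀ a, 0 ≤ targetWeight A s a * sphereDensity a := fun a ↦
    mul_nonneg (zero_le_one.trans (one_le_targetWeight A s a)) (sphereDensity_pos a).le
  have hi := integrable_targetWeight A hs hs2
  have hl := integrable_targetWeight_mul_log A x hs hs2
  refine ⟨∫ a, targetWeight A s a * sphereDensity a,
    k * (∫ a, targetWeight A s a * sphereDensity a) +
      ∫ a, targetWeight A s a * log (1 / chordalDist a x) * sphereDensity a,
    integral_nonneg hp, fun r hr ↦ ?_⟩
  have hint : Integrable fun a : ℂ ↦ (sphericalCharacteristic f r + k) *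
      (targetWeight A s a * sphereDensity a) +
        targetWeight A s a * log (1 / chordalDist a x) * sphereDensity a :=
    (hi.const_mul _).add hl
  have hle : ∀ᵐ a : ℂ, ValueDistribution.logCounting f (a : WithTop ℂ) r *
      (targetWeight A s a * sphereDensity a) ≤ (sphericalCharacteristic f r + k) *
      (targetWeight A s a * sphereDensity a) +
        targetWeight A s a * log (1 / chordalDist a x) * sphereDensity a := by
    filter_upwards [ae_coe_ne x] with a ha
    have h1 := logCounting_add_proximity hf hconst a (r := r) (by linarith)
    have h2 := proximity_nonneg (f := f) a r
    rw [hx a ha] at h1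
    calc _ ≤ (sphericalCharacteristic f r + (log (1 / chordalDist a x) + k)) *
          (targetWeight A s a * sphereDensity a) := by
          have := hp a
          gcongr
          linarith
      _ = _ := by ring
  calc _ ≤ ∫⁻ a : ℂ, ENNReal.ofReal ((sphericalCharacteristic f r + k) *
      (targetWeight A s a * sphereDensity a) +
        targetWeight A s a * log (1 / chordalDist a x) * sphereDensity a) :=
        lintegral_mono_ae (hle.mono fun a ha ↦ ENNReal.ofReal_le_ofReal ha)
    _ = ENNReal.ofReal (∫ a : ℂ, ((sphericalCharacteristic f r + k) *
      (targetWeight A s a * sphereDensity a) +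
        targetWeight A s a * log (1 / chordalDist a x) * sphereDensity a)) := by
        refine (ofReal_integral_eq_lintegral_ofReal hint ?_).symm
        filter_upwards [hle] with a ha
        exact (mul_nonneg (ValueDistribution.logCounting_nonneg hr) (hp a)).trans ha
    _ = _ := by
        rw [integral_add (hi.const_mul _) hl, integral_const_mul]
        congr 1
        ring

/-! ### Ramification and the derivative -/

/-- At a pole of order `k` the derivative has a pole of order `k + 1 = 2 * k - (k - 1)`; at a point
of multiplicity `k` with a finite value it has a zero of order `k - 1`. -/
lemma meromorphicOrderAt_deriv_eq (hf : Meromorphic f)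
    (hconst : ¬ ∃ c : ℂ, f =ᶠ[codiscrete ℂ] fun _ ↦ c) (z : ℂ) :
    meromorphicOrderAt (deriv f) z =
      ((((localMultiplicity f z - 1 : ℕ) : ℤ) - 2 * (MeromorphicOn.divisor f Set.univ)⁻ z : ℤ) :
        WithTop ℤ) := by
  have hdiv : (MeromorphicOn.divisor f Set.univ) z = (meromorphicOrderAt f z).untop₀ :=
    MeromorphicOn.divisor_apply hf.meromorphicOn (Set.mem_univ z)
  have hneg : (MeromorphicOn.divisor f Set.univ)⁻ z = (meromorphicOrderAt f z).untop₀⁻ := by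
    rw [← hdiv]; rfl
  have h0 : meromorphicOrderAt f z ≠ ⊤ := by
    simpa using meromorphicOrderAt_sub_const_ne_top hf hconst 0 z
  rcases lt_or_ge (meromorphicOrderAt f z) 0 with h | h
  · rw [hneg, localMultiplicity, if_pos h]
    lift meromorphicOrderAt f z to ℤ using h0 with n hn
    have hn0 : n < 0 := by exact_mod_cast h
    rw [meromorphicOrderAt_deriv_eq_sub_one (Int.cast_ne_zero.mpr hn0.ne) hn.symm]
    simp only [WithTop.untop₀_coe, negPart_eq_neg.2 hn0.le]
    norm_cast
    omega
  · obtain ⟨L, hL⟩ := tendsto_nhds_of_meromorphicOrderAt_nonneg (hf z) h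
    have hm : MeromorphicAt (fun w ↦ f w - L) z := (hf z).fun_sub (MeromorphicAt.const L z)
    have hpos : 0 < meromorphicOrderAt (fun w ↦ f w - L) z := by
      rw [← tendsto_zero_iff_meromorphicOrderAt_pos hm]
      simpa using hL.sub_const L
    have hd : deriv f = deriv fun w ↦ f w - L := by
      funext w; simp
    rw [hneg, localMultiplicity, if_neg (not_lt.2 h), hL.limUnder_eq, hd]
    have h1 := meromorphicOrderAt_sub_const_ne_top hf hconst L z
    lift meromorphicOrderAt (fun w ↦ f w - L) z to ℤ using h1 with m hm'
    lift meromorphicOrderAt f z to ℤ using h0 with n hn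
    have hm0 : 0 < m := by exact_mod_cast hpos
    have hn0 : 0 ≤ n := by exact_mod_cast h
    rw [meromorphicOrderAt_deriv_eq_sub_one (Int.cast_ne_zero.mpr hm0.ne') hm'.symm]
    simp only [WithTop.untop₀_coe, negPart_eq_zero.2 hn0, mul_zero, sub_zero]
    norm_cast
    omega

lemma criticalDivisor_eq (hf : Meromorphic f)
    (hconst : ¬ ∃ c : ℂ, f =ᶠ[codiscrete ℂ] fun _ ↦ c) :
    criticalDivisor f hf = MeromorphicOn.divisor (deriv f) Set.univ +
      (MeromorphicOn.divisor f Set.univ)⁻ + (MeromorphicOn.divisor f Set.univ)⁻ := by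
  ext z
  rw [Function.locallyFinsuppWithin.coe_add, Function.locallyFinsuppWithin.coe_add, Pi.add_apply,
    Pi.add_apply, MeromorphicOn.divisor_apply hf.deriv.meromorphicOn (Set.mem_univ z),
    meromorphicOrderAt_deriv_eq hf hconst z, WithTop.untop₀_coe]
  change ((localMultiplicity f z - 1 : ℕ) : ℤ) = _
  ring

/-- Jensen's formula for the derivative, in terms of the ramification of `f`. -/
lemma circleAverage_log_norm_deriv (hf : Meromorphic f)
    (hconst : ¬ ∃ c : ℂ, f =ᶠ[codiscrete ℂ] fun _ ↦ c) {r : ℝ} (hr : r ≠ 0) :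
    circleAverage (fun z ↦ log ‖deriv f z‖) 0 r =
      ramificationCounting f hf r - 2 * ValueDistribution.logCounting f ⊤ r +
        log ‖meromorphicTrailingCoeffAt (deriv f) 0‖ := by
  have h :=
    Function.locallyFinsuppWithin.logCounting_divisor_eq_circleAverage_sub_const hf.deriv hr
  rw [ramificationCounting, criticalDivisor_eq hf hconst, map_add, map_add, Pi.add_apply,
    Pi.add_apply, h, ValueDistribution.logCounting_top]
  ring

lemma eventually_codiscrete_deriv_ne_zero (hf : Meromorphic f)
    (hconst : ¬ ∃ c : ℂ, f =ᶠ[codiscrete ℂ] fun _ ↦ c) :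
    ∀ᶠ z in codiscrete ℂ, deriv f z ≠ 0 :=
  hf.deriv.meromorphicOn.eventually_codiscreteWithin_apply_ne_zero fun z _ ↦ by
    rw [meromorphicOrderAt_deriv_eq hf hconst z]
    exact WithTop.coe_ne_top

lemma eventually_codiscrete_analyticAt (hf : Meromorphic f) :
    ∀ᶠ z in codiscrete ℂ, AnalyticAt ℂ f z :=
  hf.meromorphicOn.analyticAt_mem_codiscreteWithin

lemma one_le_posPart_divisor_sub (hf : Meromorphic f)
    (hconst : ¬ ∃ c : ℂ, f =ᶠ[codiscrete ℂ] fun _ ↦ c) {z : ℂ} (hz : AnalyticAt ℂ f z) :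
    1 ≤ (MeromorphicOn.divisor (fun w ↦ f w - f z) Set.univ)⁺ z := by
  have hg : AnalyticAt ℂ (fun w ↦ f w - f z) z := hz.sub analyticAt_const
  have hm : Meromorphic fun w ↦ f w - f z := hf.fun_sub (Meromorphic.const _)
  have h1 : 0 < meromorphicOrderAt (fun w ↦ f w - f z) z := by
    rw [← tendsto_zero_iff_meromorphicOrderAt_pos hg.meromorphicAt]
    simpa using hg.continuousAt.tendsto.mono_left nhdsWithin_le_nhds
  have h2 := meromorphicOrderAt_sub_const_ne_top hf hconst (f z) z
  have h3 : (MeromorphicOn.divisor (fun w ↦ f w - f z) Set.univ) z =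
      (meromorphicOrderAt (fun w ↦ f w - f z) z).untop₀ :=
    MeromorphicOn.divisor_apply hm.meromorphicOn (Set.mem_univ z)
  have h4 : (MeromorphicOn.divisor (fun w ↦ f w - f z) Set.univ)⁺ z =
      (meromorphicOrderAt (fun w ↦ f w - f z) z).untop₀⁺ := by rw [← h3]; rfl
  lift meromorphicOrderAt (fun w ↦ f w - f z) z to ℤ using h2 with n hn
  have h5 : 0 < n := by exact_mod_cast h1
  rw [h4, WithTop.untop₀_coe, posPart_eq_self.2 h5.le]
  omega

/-- The counting function dominates the contribution of any finite set of points of a fibre. -/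
lemma sum_log_le_logCounting (hf : Meromorphic f)
    (hconst : ¬ ∃ c : ℂ, f =ᶠ[codiscrete ℂ] fun _ ↦ c) {a : ℂ} {Z : Finset ℂ}
    (hZ : ∀ z ∈ Z, AnalyticAt ℂ f z ∧ f z = a) {r : ℝ} (hr : 1 ≤ r) (hZr : ∀ z ∈ Z, ‖z‖ ≤ r) :
    ∑ z ∈ Z, (log r - log ‖z‖) ≤ ValueDistribution.logCounting f (a : WithTop ℂ) r := by
  classical
  have hle : ∑ z ∈ Z, Function.locallyFinsuppWithin.single z 1 ≤
      (MeromorphicOn.divisor (fun w ↦ f w - a) Set.univ)⁺ := by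
    intro w
    have hsum : (∑ z ∈ Z, Function.locallyFinsuppWithin.single z 1 :
        Function.locallyFinsupp ℂ ℤ) w = if w ∈ Z then 1 else 0 := by
      rw [Function.locallyFinsuppWithin.coe_sum, Finset.sum_apply]
      simp [Function.locallyFinsuppWithin.single_apply]
    rw [hsum]
    split_ifs with hw
    · obtain ⟨h1, rfl⟩ := hZ w hw
      exact one_le_posPart_divisor_sub hf hconst h1
    · exact (posPart_nonneg (MeromorphicOn.divisor (fun w ↦ f w - a) Set.univ)) w
  have h := Function.locallyFinsuppWithin.logCounting_le hle hr
  rw [← ValueDistribution.logCounting_coe, map_sum, Finset.sum_apply] at h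
  refine (Finset.sum_congr rfl fun z hz ↦ ?_).trans_le h
  rw [Function.locallyFinsuppWithin.logCounting_single_eq_log_sub_const (hZr z hz)]
  simp

/-- The characteristic of a nonconstant function grows at least like `log r`. -/
lemma exists_log_sub_le_sphericalCharacteristic (hf : Meromorphic f)
    (hconst : ¬ ∃ c : ℂ, f =ᶠ[codiscrete ℂ] fun _ ↦ c) :
    ∃ C : ℝ, ∀ᶠ r in atTop, log r - C ≤ sphericalCharacteristic f r := by
  obtain ⟨e, he⟩ := (hf 0).eventually_analyticAt.exists
  refine ⟨log ‖e‖ + jensenConstant f (f e), ?_⟩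
  filter_upwards [eventually_ge_atTop 1, eventually_ge_atTop ‖e‖] with r hr hre
  have h1 := sum_log_le_logCounting hf hconst (a := f e) (Z := {e}) (by simpa using he) hr
    (by simpa using hre)
  have h2 := logCounting_add_proximity hf hconst (f e) (r := r) (by linarith)
  have h3 : 0 ≤ proximity f (f e : ℂ) r := proximity_nonneg _ _
  rw [Finset.sum_singleton] at h1
  linarith

/-! ### Change of variables -/

lemma det_restrictScalars_deriv (c : ℂ) :
    |((ContinuousLinearMap.toSpanSingleton ℂ c).restrictScalars ℝ : ℂ →L[ℝ] ℂ).det| = ‖c‖ ^ 2 := by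
  have : (((ContinuousLinearMap.toSpanSingleton ℂ c).restrictScalars ℝ : ℂ →L[ℝ] ℂ)).det =
      ‖c‖ ^ 2 := by
    simp [ContinuousLinearMap.det, LinearMap.det_restrictScalars, Algebra.norm_complex_eq,
      Complex.normSq_eq_norm_sq]
  rw [this, abs_of_nonneg (by positivity)]

lemma exists_isOpen_injOn {z : ℂ} (hz : AnalyticAt ℂ f z) (hd : deriv f z ≠ 0) :
    ∃ U : Set ℂ, IsOpen U ∧ z ∈ U ∧ Set.InjOn f U := by
  have h := (hz.hasStrictDerivAt).hasStrictFDerivAt_equiv hd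
  exact ⟨(h.toOpenPartialHomeomorph f).source, (h.toOpenPartialHomeomorph f).open_source,
    h.mem_toOpenPartialHomeomorph_source, (h.toOpenPartialHomeomorph f).injOn⟩

/-- An open set on which `f` is locally injective is a countable disjoint union of measurable
sets on which `f` is injective. -/
lemma exists_partition_injOn {D : Set ℂ} (hD : IsOpen D)
    (hf : ∀ z ∈ D, AnalyticAt ℂ f z ∧ deriv f z ≠ 0) :
    ∃ V : ℕ → Set ℂ, (∀ n, MeasurableSet (V n)) ∧ Pairwise (Disjoint on V) ∧ ⋃ n, V n = D ∧
      ∀ n, Set.InjOn f (V n) := by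
  rcases D.eq_empty_or_nonempty with rfl | hne
  · exact ⟨fun _ ↦ ∅, fun _ ↦ .empty, fun _ _ _ ↦ by simp, by simp, by simp⟩
  have h1 : ∀ z : ℂ, ∃ U : Set ℂ, z ∈ D → IsOpen U ∧ z ∈ U ∧ Set.InjOn f U := fun z ↦ by
    by_cases hz : z ∈ D
    · obtain ⟨U, hU⟩ := exists_isOpen_injOn (hf z hz).1 (hf z hz).2
      exact ⟨U, fun _ ↦ hU⟩
    · exact ⟨∅, fun h ↦ absurd h hz⟩
  choose U hU using h1
  obtain ⟨t, htD, htc, htU⟩ := TopologicalSpace.countable_cover_nhdsWithin (f := U) (s := D)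
    fun z hz ↦ mem_nhdsWithin_of_mem_nhds ((hU z hz).1.mem_nhds (hU z hz).2.1)
  have htne : t.Nonempty := by
    obtain ⟨z, hz⟩ := hne
    obtain ⟨x, hx, -⟩ := Set.mem_iUnion₂.1 (htU hz)
    exact ⟨x, hx⟩
  obtain ⟨e, rfl⟩ := htc.exists_eq_range htne
  have he : ∀ n, e n ∈ D := fun n ↦ htD ⟨n, rfl⟩
  refine ⟨fun n ↦ D ∩ disjointed (fun n ↦ U (e n)) n, fun n ↦ ?_, ?_, ?_, fun n ↦ ?_⟩
  · exact hD.measurableSet.inter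
      (MeasurableSet.disjointed (fun n ↦ (hU (e n) (he n)).1.measurableSet) n)
  · exact fun i j hij ↦ (disjoint_disjointed _ hij).mono Set.inter_subset_right
      Set.inter_subset_right
  · rw [← Set.inter_iUnion, iUnion_disjointed, Set.inter_eq_left]
    simpa using htU
  · exact (hU (e n) (he n)).2.2.mono (Set.inter_subset_right.trans (disjointed_subset _ n))

/-- For the inequality between a sum of integrals and the integral of a majorant, no measurability
is needed: the lower integral is superadditive. -/
lemma tsum_lintegral_le {α : Type*} [MeasurableSpace α] {μ : Measure α} {ι : Type*}
    (F : ι → α → ENNReal) (G : α → ENNReal)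
    (h : ∀ s : Finset ι, ∀ a, ∑ i ∈ s, F i a ≤ G a) :
    ∑' i, ∫⁻ a, F i a ∂μ ≤ ∫⁻ a, G a ∂μ := by
  refine ENNReal.summable.tsum_le_of_sum_le fun s ↦ le_trans ?_ (lintegral_mono (h s))
  classical
  induction s using Finset.induction_on with
  | empty => simp
  | insert i s hi ih =>
    rw [Finset.sum_insert hi]
    simp_rw [Finset.sum_insert hi]
    exact (add_le_add_right ih _).trans (le_lintegral_add _ _)

/-- The inequality in the area formula: if `Φ` dominates the sum of `g` over finite subsets of each
fibre, then the integral of `g · (P ∘ f) · |f'|²` is at most that of `Φ · P`. -/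
lemma lintegral_mul_comp_le {D : Set ℂ} (hD : IsOpen D)
    (hf : ∀ z ∈ D, AnalyticAt ℂ f z ∧ deriv f z ≠ 0) (g P Φ : ℂ → ENNReal)
    (hΦ : ∀ a : ℂ, ∀ Z : Finset ℂ, (∀ z ∈ Z, z ∈ D ∧ f z = a) → ∑ z ∈ Z, g z ≤ Φ a) :
    ∫⁻ z in D, ENNReal.ofReal (‖deriv f z‖ ^ 2) * (g z * P (f z)) ≤ ∫⁻ a, Φ a * P a := by
  classical
  obtain ⟨V, hVm, hVd, hVD, hVi⟩ := exists_partition_injOn hD hf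
  have hsub : ∀ n, V n ⊆ D := fun n ↦ hVD ▸ Set.subset_iUnion V n
  let ψ : ℕ → ℂ → ℂ := fun n ↦ invFunOn f (V n)
  have hψ : ∀ n, ∀ z ∈ V n, ψ n (f z) = z := fun n z hz ↦ (hVi n).leftInvOn_invFunOn hz
  have hpiece : ∀ n, ∫⁻ z in V n, ENNReal.ofReal (‖deriv f z‖ ^ 2) * (g z * P (f z)) =
      ∫⁻ a, (f '' V n).indicator (fun a ↦ g (ψ n a) * P a) a := fun n ↦ by
    have hfd : ∀ z ∈ V n, HasFDerivWithinAt f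
        ((ContinuousLinearMap.toSpanSingleton ℂ (deriv f z)).restrictScalars ℝ : ℂ →L[ℝ] ℂ)
        (V n) z := fun z hz ↦
      ((hf z (hsub n hz)).1.differentiableAt.hasDerivAt.hasFDerivAt.restrictScalars
        ℝ).hasFDerivWithinAt
    have hmeas : MeasurableSet (f '' V n) := measurable_image_of_fderivWithin (hVm n) hfd (hVi n)
    rw [lintegral_indicator hmeas, lintegral_image_eq_lintegral_abs_det_fderiv_mul volume (hVm n)
      hfd (hVi n)]
    refine setLIntegral_congr_fun (hVm n) fun z hz ↦ ?_
    simp only [det_restrictScalars_deriv, hψ n z hz]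
  rw [← hVD, lintegral_iUnion hVm hVd, tsum_congr hpiece]
  refine tsum_lintegral_le _ _ fun s a ↦ ?_
  have hfib : ∀ n, a ∈ f '' V n → ψ n a ∈ V n ∧ f (ψ n a) = a := fun n hn ↦
    ⟨invFunOn_mem hn, invFunOn_eq hn⟩
  let s' := s.filter fun n ↦ a ∈ f '' V n
  have hinj : Set.InjOn (fun n ↦ ψ n a) s' := fun i hi j hj hij ↦ by
    by_contra hne
    have hi' := (hfib i (Finset.mem_filter.1 hi).2).1
    have hj' := (hfib j (Finset.mem_filter.1 hj).2).1
    have hij' : ψ i a = ψ j a := hij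
    exact Set.disjoint_left.1 (hVd hne) hi' (hij' ▸ hj')
  calc ∑ n ∈ s, (f '' V n).indicator (fun a ↦ g (ψ n a) * P a) a
      = ∑ n ∈ s', g (ψ n a) * P a := by
        rw [Finset.sum_filter]
        exact Finset.sum_congr rfl fun n _ ↦ by rw [Set.indicator_apply]
    _ = (∑ z ∈ s'.image fun n ↦ ψ n a, g z) * P a := by
        rw [Finset.sum_image hinj, Finset.sum_mul]
    _ ≤ Φ a * P a := by
        gcongr
        refine hΦ a _ fun z hz ↦ ?_
        obtain ⟨n, hn, rfl⟩ := Finset.mem_image.1 hz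
        have := hfib n (Finset.mem_filter.1 hn).2
        exact ⟨hsub n this.1, this.2⟩

/-- The set where `f` is analytic and locally injective. -/
def regularSet (f : ℂ → ℂ) : Set ℂ := {z | AnalyticAt ℂ f z ∧ deriv f z ≠ 0}

lemma isOpen_regularSet (f : ℂ → ℂ) : IsOpen (regularSet f) := by
  rw [isOpen_iff_mem_nhds]
  rintro z ⟨h1, h2⟩
  filter_upwards [h1.eventually_analyticAt, h1.deriv.continuousAt.eventually_ne h2] with w h3 h4
  exact ⟨h3, h4⟩

lemma ae_mem_regularSet (hf : Meromorphic f)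
    (hconst : ¬ ∃ c : ℂ, f =ᶠ[codiscrete ℂ] fun _ ↦ c) : ∀ᵐ z, z ∈ regularSet f := by
  have h := ae_restrict_le_codiscreteWithin (μ := (volume : Measure ℂ)) MeasurableSet.univ
    ((eventually_codiscrete_analyticAt hf).and (eventually_codiscrete_deriv_ne_zero hf hconst))
  rwa [Measure.restrict_univ] at h

/-- The integrated area of the image, weighted by `targetWeight`, is controlled by the
characteristic. -/
lemma exists_lintegral_area_le (hf : Meromorphic f)
    (hconst : ¬ ∃ c : ℂ, f =ᶠ[codiscrete ℂ] fun _ ↦ c) (A : Finset (OnePoint ℂ)) {s : ℝ}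
    (hs : 0 < s) (hs2 : s < 2) :
    ∃ C₁ C₂ : ℝ, 0 ≤ C₁ ∧ ∀ r : ℝ, 1 ≤ r →
      ∫⁻ z : ℂ, ENNReal.ofReal (log⁺ (r / ‖z‖)) * ENNReal.ofReal (targetWeight A s (f z) *
        sphereDensity (f z) * ‖deriv f z‖ ^ 2) ≤
          ENNReal.ofReal (C₁ * sphericalCharacteristic f r + C₂) := by
  obtain ⟨C₁, C₂, hC₁, h⟩ := exists_lintegral_logCounting_le hf hconst A hs hs2
  refine ⟨C₁, C₂, hC₁, fun r hr ↦ le_trans ?_ (h r hr)⟩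
  have hp : ∀ a, 0 ≤ targetWeight A s a * sphereDensity a := fun a ↦
    mul_nonneg (zero_le_one.trans (one_le_targetWeight A s a)) (sphereDensity_pos a).le
  have hkey := lintegral_mul_comp_le (isOpen_regularSet f) (fun z hz ↦ hz)
    (fun z ↦ ENNReal.ofReal (log⁺ (r / ‖z‖)))
    (fun a ↦ ENNReal.ofReal (targetWeight A s a * sphereDensity a))
    (fun a ↦ ENNReal.ofReal (ValueDistribution.logCounting f (a : WithTop ℂ) r))
    fun a Z hZ ↦ by
      rw [← ENNReal.ofReal_sum_of_nonneg fun _ _ ↦ posLog_nonneg]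
      refine ENNReal.ofReal_le_ofReal ?_
      refine le_trans ?_ (sum_log_le_logCounting hf hconst (Z := Z.filter fun z ↦ ‖z‖ ≤ r)
        (fun z hz ↦ ?_) hr fun z hz ↦ (Finset.mem_filter.1 hz).2)
      · rw [Finset.sum_filter]
        refine Finset.sum_le_sum fun z _ ↦ ?_
        rcases eq_or_ne z 0 with rfl | hz0
        · simp [(zero_le_one.trans hr), Real.log_nonneg hr]
        have hzp : 0 < ‖z‖ := norm_pos_iff.2 hz0
        split_ifs with hzr
        · rw [posLog_eq_log (by rw [abs_of_pos (by positivity)]; exact (one_le_div hzp).2 hzr),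
            Real.log_div (by linarith) hzp.ne']
        · rw [posLog_eq_zero_iff _ |>.2]
          rw [abs_of_pos (by positivity)]
          exact (div_le_one hzp).2 (not_le.1 hzr).le
      · have := hZ z (Finset.mem_filter.1 hz).1
        exact ⟨this.1.1, this.2⟩
  rw [Measure.restrict_eq_self_of_ae_mem (ae_mem_regularSet hf hconst)] at hkey
  refine le_of_eq_of_le (lintegral_congr fun z ↦ ?_) (hkey.trans_eq (lintegral_congr fun a ↦ ?_))
  · rw [ENNReal.ofReal_mul (hp _)]
    ring
  · rw [ENNReal.ofReal_mul (ValueDistribution.logCounting_nonneg hr)]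

/-! ### Growth lemmas -/

/-- Borel's growth lemma for a monotone function: `-h^(-δ)` is monotone and bounded, and where
`h^(1+δ) < h'` its derivative exceeds `δ`. -/
lemma volume_lt_deriv_lt_top {h : ℝ → ℝ} (hm : MonotoneOn h (Set.Ici 1))
    (h1 : ∀ r, 1 ≤ r → 1 ≤ h r) {δ : ℝ} (hδ : 0 < δ) :
    volume {r | 1 < r ∧ h r ^ (1 + δ) < deriv h r} < ⊤ := by
  let κ : ℝ → ℝ := fun r ↦ -(h r ^ (-δ))
  have hκm : MonotoneOn κ (Set.Ici 1) := fun x hx y hy hxy ↦ by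
    have := Real.rpow_le_rpow_of_nonpos (lt_of_lt_of_le one_pos (h1 x hx)) (hm hx hy hxy)
      (neg_nonpos.2 hδ.le)
    exact neg_le_neg this
  have hκ : ∀ r, 1 ≤ r → -1 ≤ κ r ∧ κ r ≤ 0 := fun r hr ↦
    ⟨neg_le_neg (Real.rpow_le_one_of_one_le_of_nonpos (h1 r hr) (neg_nonpos.2 hδ.le)),
      neg_nonpos.2 (Real.rpow_nonneg (zero_le_one.trans (h1 r hr)) _)⟩
  have hnn : ∀ r, 1 < r → 0 ≤ deriv κ r := fun r hr ↦ by
    rw [← derivWithin_of_mem_nhds (Ici_mem_nhds hr)]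
    exact hκm.derivWithin_nonneg
  have hsub : {r | 1 < r ∧ h r ^ (1 + δ) < deriv h r} ⊆ {r | 1 < r ∧ δ ≤ deriv κ r} := by
    rintro r ⟨hr, hlt⟩
    have hp : 0 < h r := lt_of_lt_of_le one_pos (h1 r hr.le)
    have hdiff : DifferentiableAt ℝ h r := by
      by_contra hnd
      rw [deriv_zero_of_not_differentiableAt hnd] at hlt
      exact absurd hlt (not_lt.2 (Real.rpow_nonneg hp.le _))
    have hd := (hdiff.hasDerivAt.rpow_const (p := -δ) (Or.inl hp.ne')).fun_neg
    refine ⟨hr, ?_⟩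
    rw [show deriv κ r = _ from hd.deriv]
    have h2 : h r ^ (1 + δ) * h r ^ (-δ - 1) = 1 := by
      rw [← Real.rpow_add hp, show 1 + δ + (-δ - 1) = 0 by ring, Real.rpow_zero]
    have h3 := mul_le_mul_of_nonneg_right hlt.le (Real.rpow_nonneg hp.le (-δ - 1))
    rw [h2] at h3
    nlinarith
  refine (measure_mono hsub).trans_lt ?_
  have hn : ∀ n : ℕ, volume ({r | 1 < r ∧ δ ≤ deriv κ r} ∩ Set.Iic (n + 1)) ≤
      1 / ENNReal.ofReal δ := fun n ↦ by
    have hle : (1 : ℝ) ≤ n + 1 := by linarith [n.cast_nonneg (α := ℝ)]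
    have hmon : MonotoneOn κ (Set.uIcc 1 (n + 1)) :=
      hκm.mono (by rw [Set.uIcc_of_le hle]; exact Set.Icc_subset_Ici_self)
    have hint := hmon.intervalIntegrable_deriv
    have hmem := hmon.intervalIntegral_deriv_mem_uIcc
    rw [Set.uIcc_of_le (sub_nonneg.2 (hκm Set.self_mem_Ici hle hle))] at hmem
    have hle1 : ∫ x in (1 : ℝ)..(n + 1), deriv κ x ≤ 1 := by
      linarith [hmem.2, (hκ 1 le_rfl).1, (hκ (n + 1) hle).2]
    rw [intervalIntegral.integral_of_le hle] at hle1
    rw [intervalIntegrable_iff_integrableOn_Ioc_of_le hle] at hint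
    have hl : ∫⁻ x in Set.Ioc 1 ((n : ℝ) + 1), ENNReal.ofReal (deriv κ x) ≤ 1 := by
      rw [← ofReal_integral_eq_lintegral_ofReal hint]
      · exact (ENNReal.ofReal_le_ofReal hle1).trans (by simp)
      · exact (ae_restrict_iff' measurableSet_Ioc).2 (ae_of_all _ fun x hx ↦ hnn x hx.1)
    have hmk := meas_ge_le_lintegral_div (μ := volume.restrict (Set.Ioc 1 ((n : ℝ) + 1)))
      (measurable_deriv κ).ennreal_ofReal.aemeasurable (ε := ENNReal.ofReal δ)
      (by simpa using hδ) ENNReal.ofReal_ne_top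
    refine le_trans ?_ (hmk.trans (ENNReal.div_le_div_right hl _))
    rw [Measure.restrict_apply' measurableSet_Ioc]
    exact measure_mono fun x hx ↦ ⟨ENNReal.ofReal_le_ofReal hx.1.2, hx.1.1, hx.2⟩
  have hU : {r | 1 < r ∧ δ ≤ deriv κ r} =
      ⋃ n : ℕ, {r | 1 < r ∧ δ ≤ deriv κ r} ∩ Set.Iic ((n : ℝ) + 1) := by
    rw [← Set.inter_iUnion, Set.left_eq_inter]
    intro x _
    obtain ⟨n, hn⟩ := exists_nat_ge x
    exact Set.mem_iUnion.2 ⟨n, show x ≤ n + 1 by linarith⟩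
  have hmono : Monotone fun n : ℕ ↦ {r | 1 < r ∧ δ ≤ deriv κ r} ∩ Set.Iic ((n : ℝ) + 1) :=
    fun i j hij ↦ Set.inter_subset_inter_right _ (Set.Iic_subset_Iic.2 (by gcongr))
  rw [hU, hmono.measure_iUnion]
  refine (iSup_le hn).trans_lt (ENNReal.div_lt_top ENNReal.one_ne_top ?_)
  simpa using hδ

/-- The logarithmic mean `∫₀^∞ log⁺ (r / t) ψ(t) dt`, which equals `∫₀^r (∫₀^s ψ) ds / s`. -/
noncomputable def logMean (ψ : ℝ → ENNReal) (r : ℝ) : ENNReal :=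
  ∫⁻ t in Set.Ioi 0, ENNReal.ofReal (log⁺ (r / t)) * ψ t

lemma logMean_mono (ψ : ℝ → ENNReal) {r s : ℝ} (hr : 0 < r) (hrs : r ≤ s) :
    logMean ψ r ≤ logMean ψ s := by
  refine setLIntegral_mono' measurableSet_Ioi fun t ht ↦ ?_
  have ht' : (0 : ℝ) < t := ht
  gcongr

/-- The increment of the logarithmic mean from `r` to `s` is at least `log (s / r)` times the
integral of `ψ` up to `r`. -/
lemma logMean_add_le {ψ : ℝ → ENNReal} (hψ : Measurable ψ) {r s : ℝ} (hr : 0 < r) (hrs : r ≤ s) :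
    logMean ψ r + ENNReal.ofReal (log (s / r)) * ∫⁻ t in Set.Ioc 0 r, ψ t ≤ logMean ψ s := by
  have h1 : ∫⁻ t in Set.Ioc 0 r, ψ t = ∫⁻ t in Set.Ioi 0, (Set.Iic r).indicator ψ t := by
    rw [lintegral_indicator measurableSet_Iic, Measure.restrict_restrict measurableSet_Iic,
      Set.Iic_inter_Ioi]
  have hm : Measurable fun t ↦ ENNReal.ofReal (log⁺ (r / t)) * ψ t :=
    (continuous_posLog.measurable.comp (measurable_const.div measurable_id)).ennreal_ofReal.mul hψ
  rw [h1, logMean, ← lintegral_const_mul _ (hψ.indicator measurableSet_Iic), ← lintegral_add_left hm]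
  refine setLIntegral_mono' measurableSet_Ioi fun t ht ↦ ?_
  have ht' : (0 : ℝ) < t := ht
  have hs : 0 < s := hr.trans_le hrs
  by_cases htr : t ≤ r
  · rw [Set.indicator_of_mem (show t ∈ Set.Iic r from htr), ← add_mul,
      ← ENNReal.ofReal_add posLog_nonneg (Real.log_nonneg ((one_le_div hr).2 hrs))]
    gcongr
    have e1 : 1 ≤ |r / t| := by rw [abs_of_pos (by positivity)]; exact (one_le_div ht').2 htr
    have e2 : 1 ≤ |s / t| := by
      rw [abs_of_pos (by positivity)]; exact (one_le_div ht').2 (htr.trans hrs)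
    rw [posLog_eq_log e1, posLog_eq_log e2, Real.log_div hr.ne' ht'.ne', Real.log_div hs.ne' hr.ne',
      Real.log_div hs.ne' ht'.ne']
    linarith
  · rw [Set.indicator_of_notMem (show t ∉ Set.Iic r from htr), mul_zero, add_zero]
    gcongr

/-- If the logarithmic mean of `ψ` is finite, then outside a set of finite measure `ψ` is bounded by
the fourth power of the mean plus `1`, times a power of `r` with exponent near `1`. The growth lemma
is applied to the logarithmic mean, whose derivative is `(∫₀^r ψ) / r`, and to `∫₀^r ψ`. The exponent
`4` stands for `(1 + δ)²`. -/
lemma exists_le_logMean {ψ : ℝ → ENNReal} (hψ : Measurable ψ)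
    (hK : ∀ r, 1 ≤ r → logMean ψ r ≠ ⊤) {δ : ℝ} (hδ : 0 < δ) (hδ1 : δ ≤ 1) :
    ∃ E : Set ℝ, volume E < ⊤ ∧ ∀ r, 1 ≤ r → r ∉ E →
      ψ r ≤ ENNReal.ofReal ((2 * r) ^ (1 + δ) * ((logMean ψ r).toReal + 1) ^ 4) := by
  let k : ℝ → ℝ := fun r ↦ (logMean ψ r).toReal + 1
  let β : ℝ → ℝ := fun r ↦ (∫⁻ t in Set.Ioc 0 r, ψ t).toReal + 1
  have hB : ∀ r, ∫⁻ t in Set.Ioc 0 r, ψ t ≠ ⊤ := fun r ↦ by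
    have hR : 1 ≤ max r 1 := le_max_right _ _
    have h1 := logMean_add_le hψ (r := max r 1) (s := exp 1 * max r 1) (by linarith)
      (le_mul_of_one_le_left (by linarith) (Real.one_le_exp zero_le_one))
    rw [mul_div_cancel_right₀ _ (by linarith), Real.log_exp, ENNReal.ofReal_one, one_mul] at h1
    refine ne_top_of_le_ne_top (hK (exp 1 * max r 1)
      (one_le_mul_of_one_le_of_one_le (Real.one_le_exp zero_le_one) hR))
      (le_trans (le_trans ?_ le_add_self) h1)
    exact lintegral_mono_set (Set.Ioc_subset_Ioc_right (le_max_left _ _))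
  have hkm : MonotoneOn k (Set.Ici 1) := fun x hx y hy hxy ↦ by
    have hx' : (1 : ℝ) ≤ x := hx
    exact add_le_add_left (ENNReal.toReal_mono (hK y hy) (logMean_mono ψ (by linarith) hxy)) 1
  have hβm : MonotoneOn β (Set.Ici 1) := fun x _ y _ hxy ↦
    add_le_add_left (ENNReal.toReal_mono (hB y)
      (lintegral_mono_set (Set.Ioc_subset_Ioc_right hxy))) 1
  have hk1 : ∀ r, 1 ≤ k r := fun r ↦ le_add_of_nonneg_left ENNReal.toReal_nonneg
  have hβ1 : ∀ r, 1 ≤ β r := fun r ↦ le_add_of_nonneg_left ENNReal.toReal_nonneg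
  -- the derivative of `k` is at least `β / r`
  have hkd : ∀ r, 1 < r → DifferentiableAt ℝ k r → β r ≤ r * deriv k r + 1 := fun r hr hd ↦ by
    have hr0 : 0 < r := by linarith
    let g : ℝ → ℝ := fun s ↦ k s - (β r - 1) * log s
    have hg : HasDerivAt g (deriv k r - (β r - 1) * r⁻¹) r :=
      hd.hasDerivAt.sub ((Real.hasDerivAt_log hr0.ne').const_mul _)
    have hge : ∀ s, r < s → g r ≤ g s := fun s hs ↦ by
      have h1 := logMean_add_le hψ hr0 hs.le
      have h2 := ENNReal.toReal_mono (hK s (by linarith)) h1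
      rw [ENNReal.toReal_add (hK r hr.le) (ENNReal.mul_ne_top ENNReal.ofReal_ne_top (hB r)),
        ENNReal.toReal_mul, ENNReal.toReal_ofReal (Real.log_nonneg ((one_le_div hr0).2 hs.le)),
        Real.log_div (by linarith) hr0.ne'] at h2
      simp only [g, k, β]
      linarith
    have hnn : 0 ≤ deriv k r - (β r - 1) * r⁻¹ := by
      have ht := (hasDerivAt_iff_tendsto_slope.1 hg).mono_left
        (nhdsGT_le_nhdsNE r)
      refine ge_of_tendsto ht ?_
      filter_upwards [self_mem_nhdsWithin] with s hs
      have hs' : r < s := hs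
      rw [slope_def_field]
      exact div_nonneg (sub_nonneg.2 (hge s hs')) (sub_nonneg.2 hs'.le)
    have : (β r - 1) * r⁻¹ * r = β r - 1 := by field_simp
    nlinarith
  have hae1 := hkm.ae_differentiableWithinAt_of_mem
  let b : ℝ → ℝ := (Set.Ioi 0).indicator fun t ↦ (ψ t).toReal
  have hfin : ∀ r, ∀ᵐ t ∂volume.restrict (Set.Ioc 0 r), ψ t < ⊤ := fun r ↦ ae_lt_top hψ (hB r)
  have hae2 : ∀ᵐ t, t ∈ Set.Ioi (0 : ℝ) → ψ t < ⊤ := by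
    have : ∀ n : ℕ, ∀ᵐ t : ℝ, t ∈ Set.Ioc (0 : ℝ) n → ψ t < ⊤ := fun n ↦
      (ae_restrict_iff' measurableSet_Ioc).1 (hfin n)
    filter_upwards [ae_all_iff.2 this] with t ht h0
    obtain ⟨n, hn⟩ := exists_nat_ge t
    exact ht n ⟨h0, hn⟩
  have hbi : ∀ r, IntegrableOn b (Set.Ioc 0 r) := fun r ↦ by
    have : IntegrableOn (fun t ↦ (ψ t).toReal) (Set.Ioc 0 r) :=
      integrable_toReal_of_lintegral_ne_top hψ.aemeasurable (hB r)
    exact this.congr_fun (fun t ht ↦ (Set.indicator_of_mem (show t ∈ Set.Ioi (0 : ℝ) from ht.1)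
      fun t ↦ (ψ t).toReal).symm) measurableSet_Ioc
  have hbl : LocallyIntegrable b := by
    rw [locallyIntegrable_iff]
    intro C hC
    obtain ⟨R, hR⟩ := hC.bddAbove
    have h1 : IntegrableOn b (Set.Iic (max 0 R)) := by
      rw [← Set.Iic_union_Ioc_eq_Iic (le_max_left 0 R)]
      refine IntegrableOn.union ?_ (hbi _)
      exact integrableOn_zero.congr_fun (fun t ht ↦ (Set.indicator_of_notMem
        (show t ∉ Set.Ioi (0 : ℝ) from Set.notMem_Ioi.2 ht) fun t ↦ (ψ t).toReal).symm)
        measurableSet_Iic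
    exact h1.mono_set fun x hx ↦ (hR hx).trans (le_max_right _ _)
  have hae3 := LocallyIntegrable.ae_hasDerivAt_integral hbl
  -- the two exceptional sets of the growth lemma, and a null set where `ψ` is infinite or where `k`
  -- or `β` does not have the expected derivative
  refine ⟨{r | 1 < r ∧ k r ^ (1 + δ) < deriv k r} ∪ {r | 1 < r ∧ β r ^ (1 + δ) < deriv β r} ∪
    {1} ∪ {r | ¬ ((r ∈ Set.Ici 1 → DifferentiableWithinAt ℝ k (Set.Ici 1) r) ∧
      (r ∈ Set.Ioi (0 : ℝ) → ψ r < ⊤) ∧ ∀ c, HasDerivAt (fun x ↦ ∫ t in c..x, b t) (b r) r)},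
    ?_, fun r hr hrE ↦ ?_⟩
  · have h0 : volume {r | ¬ ((r ∈ Set.Ici 1 → DifferentiableWithinAt ℝ k (Set.Ici 1) r) ∧
      (r ∈ Set.Ioi (0 : ℝ) → ψ r < ⊤) ∧
        ∀ c, HasDerivAt (fun x ↦ ∫ t in c..x, b t) (b r) r)} = 0 :=
      ae_iff.1 (hae1.and (hae2.and hae3))
    refine measure_union_lt_top (measure_union_lt_top (measure_union_lt_top
      (volume_lt_deriv_lt_top hkm (fun r _ ↦ hk1 r) hδ)
      (volume_lt_deriv_lt_top hβm (fun r _ ↦ hβ1 r) hδ)) (by simp)) (by rw [h0]; simp)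
  simp only [Set.mem_union, not_or, Set.mem_singleton_iff] at hrE
  obtain ⟨⟨⟨hE1', hE2'⟩, hne⟩, hE3⟩ := hrE
  have hE1 : 1 < r → deriv k r ≤ k r ^ (1 + δ) := fun h ↦ not_lt.1 fun h' ↦ hE1' ⟨h, h'⟩
  have hE2 : 1 < r → deriv β r ≤ β r ^ (1 + δ) := fun h ↦ not_lt.1 fun h' ↦ hE2' ⟨h, h'⟩
  obtain ⟨hk, hψr, hβ⟩ := not_not.1 hE3
  have hr1 : 1 < r := lt_of_le_of_ne hr (Ne.symm hne)
  have hr0 : 0 < r := by linarith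
  have hkd' := hkd r hr1 ((hk hr).differentiableAt (Ici_mem_nhds hr1))
  have hβd : deriv β r = (ψ r).toReal := by
    have h1 := (hβ 0).add_const 1
    have h2 : b r = (ψ r).toReal := Set.indicator_of_mem (show r ∈ Set.Ioi (0 : ℝ) from hr0) _
    rw [← h2, ← h1.deriv]
    refine Filter.EventuallyEq.deriv_eq ?_
    filter_upwards [lt_mem_nhds hr0] with x hx
    have h3 : ∫ t in (0 : ℝ)..x, b t = (∫⁻ t in Set.Ioc 0 x, ψ t).toReal := by
      rw [intervalIntegral.integral_of_le hx.le, ← integral_toReal hψ.aemeasurable (hfin x)]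
      exact setIntegral_congr_fun measurableSet_Ioc fun t ht ↦
        Set.indicator_of_mem (show t ∈ Set.Ioi (0 : ℝ) from ht.1) _
    simp only [β, h3]
  have h1 : (ψ r).toReal ≤ β r ^ (1 + δ) := hβd ▸ hE2 hr1
  have hkp : 1 ≤ k r ^ (1 + δ) := Real.one_le_rpow (hk1 r) (by linarith)
  have h2 : β r ≤ (2 * r) * k r ^ (1 + δ) := by
    have := mul_le_mul_of_nonneg_left (hE1 hr1) hr0.le
    nlinarith
  rw [← ENNReal.ofReal_toReal (hψr hr0).ne]
  refine ENNReal.ofReal_le_ofReal (h1.trans ?_)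
  calc β r ^ (1 + δ) ≤ ((2 * r) * k r ^ (1 + δ)) ^ (1 + δ) := by
        have := hβ1 r
        gcongr
    _ = (2 * r) ^ (1 + δ) * k r ^ ((1 + δ) * (1 + δ)) := by
        rw [Real.mul_rpow (by positivity) (by positivity), ← Real.rpow_mul (by linarith [hk1 r])]
    _ ≤ (2 * r) ^ (1 + δ) * k r ^ (4 : ℝ) := by
        gcongr
        · exact hk1 r
        · nlinarith
    _ = _ := by
        rw [show (4 : ℝ) = ((4 : ℕ) : ℝ) by norm_num, Real.rpow_natCast]

/-! ### Polar coordinates and circle averages -/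

/-- The mass that the measure with density `F` puts on the circle of radius `t`, as a density in
`t`. -/
noncomputable def radialMass (F : ℂ → ENNReal) (t : ℝ) : ENNReal :=
  ENNReal.ofReal t * ∫⁻ θ in Set.Ioo (-π) π, F (circleMap 0 t θ)

lemma measurable_comp_circleMap {F : ℂ → ENNReal} (hF : Measurable F) :
    Measurable fun p : ℝ × ℝ ↦ F (circleMap 0 p.1 p.2) :=
  hF.comp circleMap.continuous.measurable

lemma measurable_radialMass {F : ℂ → ENNReal} (hF : Measurable F) : Measurable (radialMass F) :=
  ENNReal.measurable_ofReal.mul (measurable_comp_circleMap hF).lintegral_prod_right'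

/-- The area integral of `exists_lintegral_area_le` in polar coordinates. -/
lemma lintegral_log_mul_eq_logMean {F : ℂ → ENNReal} (hF : Measurable F) (r : ℝ) :
    ∫⁻ z, ENNReal.ofReal (log⁺ (r / ‖z‖)) * F z = logMean (radialMass F) r := by
  have hm := measurable_comp_circleMap hF
  have hsymm : ∀ p : ℝ × ℝ, Complex.polarCoord.symm p = circleMap 0 p.1 p.2 := fun p ↦ by
    simp [circleMap, Complex.exp_mul_I]
  have hlog : Measurable fun t : ℝ ↦ ENNReal.ofReal (log⁺ (r / t)) :=
    (continuous_posLog.measurable.comp (measurable_const.div measurable_id)).ennreal_ofReal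
  rw [← Complex.lintegral_comp_polarCoord_symm]
  have htarget : polarCoord.target = Set.Ioi (0 : ℝ) ×ˢ Set.Ioo (-π) π := rfl
  rw [htarget, Measure.volume_eq_prod, ← Measure.prod_restrict]
  have hcongr : ∀ᵐ p ∂(volume.restrict (Set.Ioi (0 : ℝ))).prod (volume.restrict (Set.Ioo (-π) π)),
      ENNReal.ofReal p.1 • (ENNReal.ofReal (log⁺ (r / ‖Complex.polarCoord.symm p‖)) *
        F (Complex.polarCoord.symm p)) =
      ENNReal.ofReal (log⁺ (r / p.1)) * (ENNReal.ofReal p.1 * F (circleMap 0 p.1 p.2)) := by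
    rw [Measure.prod_restrict]
    refine (ae_restrict_iff' (measurableSet_Ioi.prod measurableSet_Ioo)).2 (ae_of_all _ ?_)
    rintro ⟨t, θ⟩ ⟨ht, -⟩
    have ht' : (0 : ℝ) < t := ht
    rw [Complex.norm_polarCoord_symm, abs_of_pos ht', hsymm, smul_eq_mul, mul_left_comm]
  rw [lintegral_congr_ae hcongr, lintegral_prod]
  · refine setLIntegral_congr_fun measurableSet_Ioi fun t _ ↦ ?_
    have hFt : Measurable fun θ ↦ F (circleMap 0 t θ) :=
      hF.comp (continuous_circleMap 0 t).measurable
    dsimp only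
    rw [lintegral_const_mul _ (hFt.const_mul _), lintegral_const_mul _ hFt, radialMass]
  · exact ((hlog.comp measurable_fst).mul ((ENNReal.measurable_ofReal.comp measurable_fst).mul
      hm)).aemeasurable

/-- A form of Jensen's inequality for the logarithm: if `L ≤ log W` on a circle and the mean of `W`
is at most `M`, then the mean of `L` is at most `log M`. -/
lemma circleAverage_le_log {L W : ℂ → ℝ} {r M : ℝ} (hr : r ≠ 0) (hM : 0 < M)
    (hW0 : ∀ z, 0 ≤ W z) (hWm : Measurable W) (hL : CircleIntegrable L 0 r)
    (hLW : ∀ᶠ z in codiscrete ℂ, 0 < W z ∧ L z ≤ log (W z))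
    (hWM : ∫⁻ θ in Set.Ioo (-π) π, ENNReal.ofReal (W (circleMap 0 r θ)) ≤
      ENNReal.ofReal (2 * π * M)) :
    circleAverage L 0 r ≤ log M := by
  have hper : Function.Periodic (fun θ ↦ W (circleMap 0 r θ)) (2 * π) := fun θ ↦ by
    simp only [periodic_circleMap 0 r θ]
  have hm : Measurable fun θ ↦ W (circleMap 0 r θ) := hWm.comp (continuous_circleMap 0 r).measurable
  have hint : Integrable (fun θ ↦ W (circleMap 0 r θ)) (volume.restrict (Set.Ioo (-π) π)) := by
    refine ⟨hm.aestronglyMeasurable, ?_⟩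
    rw [hasFiniteIntegral_iff_ofReal (ae_of_all _ fun θ ↦ hW0 _)]
    exact hWM.trans_lt ENNReal.ofReal_lt_top
  have hint' : IntervalIntegrable (fun θ ↦ W (circleMap 0 r θ)) volume (-π) (-π + 2 * π) := by
    rw [show -π + 2 * π = π by ring,
      intervalIntegrable_iff_integrableOn_Ioo_of_le (by linarith [pi_pos])]
    exact hint
  have hWi : CircleIntegrable W 0 r := hper.intervalIntegrable two_pi_pos.ne' hint' 0 (2 * π)
  have havg : circleAverage W 0 r ≤ M := by
    have h1 : ∫ θ in Set.Ioo (-π) π, W (circleMap 0 r θ) ≤ 2 * π * M := by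
      rw [← ENNReal.ofReal_le_ofReal_iff (by positivity),
        ofReal_integral_eq_lintegral_ofReal hint (ae_of_all _ fun θ ↦ hW0 _)]
      exact hWM
    have h2 := hper.intervalIntegral_add_eq 0 (-π)
    rw [zero_add, intervalIntegral.integral_of_le (a := -π) (by linarith [pi_pos]),
      integral_Ioc_eq_integral_Ioo, show -π + 2 * π = π by ring] at h2
    rw [circleAverage_def, h2, smul_eq_mul, inv_mul_le_iff₀ two_pi_pos]
    exact h1
  -- the tangent line of the logarithm at `M`
  let g : ℂ → ℝ := fun z ↦ M⁻¹ * W z + (log M - 1)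
  have hgi : CircleIntegrable g 0 r :=
    (hWi.const_mul M⁻¹).add (circleIntegrable_const (log M - 1) 0 r)
  have hLg : L =ᶠ[codiscreteWithin (Metric.sphere 0 |r|)] fun z ↦ min (L z) (g z) := by
    filter_upwards [hLW.filter_mono (codiscreteWithin_mono (Set.subset_univ _))] with z ⟨h0, h1⟩
    refine (min_eq_left (h1.trans ?_)).symm
    have h2 := Real.log_le_sub_one_of_pos (x := M⁻¹ * W z) (by positivity)
    rw [Real.log_mul (by positivity) h0.ne', Real.log_inv] at h2
    simp only [g]
    linarith
  rw [circleAverage_congr_codiscreteWithin hLg hr]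
  refine (circleAverage_mono (hL.congr_codiscreteWithin hLg) hgi fun z _ ↦ min_le_right _ _).trans ?_
  have hg : circleAverage g 0 r = M⁻¹ * circleAverage W 0 r + (log M - 1) := by
    have h0 : CircleIntegrable (fun z ↦ M⁻¹ * W z) 0 r := hWi.const_mul M⁻¹
    have h1 := circleAverage_fun_add h0 (circleIntegrable_const (log M - 1) 0 r)
    have h2 := circleAverage_fun_smul (a := M⁻¹) (f := W) (c := 0) (R := r)
    simp only [smul_eq_mul] at h2
    rw [circleAverage_const, h2] at h1
    exact h1
  rw [hg]
  have : M⁻¹ * circleAverage W 0 r ≤ 1 := by rwa [inv_mul_le_iff₀ hM, mul_one]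
  linarith

/-- The density of the pull-back under `f` of the measure `targetWeight A s` times the spherical
area. -/
noncomputable def pullbackDensity (f : ℂ → ℂ) (A : Finset (OnePoint ℂ)) (s : ℝ) (z : ℂ) : ℝ :=
  targetWeight A s (f z) * sphereDensity (f z) * ‖deriv f z‖ ^ 2

lemma pullbackDensity_nonneg (A : Finset (OnePoint ℂ)) (s : ℝ) (z : ℂ) :
    0 ≤ pullbackDensity f A s z :=
  mul_nonneg (mul_nonneg (zero_le_one.trans (one_le_targetWeight A s _)) (sphereDensity_pos _).le)
    (by positivity)

lemma measurable_pullbackDensity (hf : Meromorphic f) (A : Finset (OnePoint ℂ)) (s : ℝ) :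
    Measurable (pullbackDensity f A s) :=
  (((measurable_targetWeight A s).comp hf.measurable).mul
    (continuous_sphereDensity.measurable.comp hf.measurable)).mul
    ((measurable_deriv f).norm.pow_const 2)

lemma log_sphereDensity (w : ℂ) : log (sphereDensity w) = -log π - 4 * log √(1 + ‖w‖ ^ 2) := by
  rw [sphereDensity, one_div, Real.log_inv, Real.log_mul (by positivity) (by positivity),
    Real.log_pow, Real.log_sqrt (by positivity)]
  push_cast
  ring

/-- The logarithm of `pullbackDensity` has mean at least `s ∑ m(r, a) + 2 N₁(r) - 4 T(r) - C`. -/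
lemma exists_sum_proximity_le_log (hf : Meromorphic f)
    (hconst : ¬ ∃ c : ℂ, f =ᶠ[codiscrete ℂ] fun _ ↦ c) (A : Finset (OnePoint ℂ)) {s : ℝ}
    (hs : 0 < s) :
    ∃ C : ℝ, ∀ r : ℝ, 0 < r → ∀ M : ℝ, 0 < M →
      (∫⁻ θ in Set.Ioo (-π) π, ENNReal.ofReal (pullbackDensity f A s (circleMap 0 r θ)) ≤
        ENNReal.ofReal (2 * π * M)) →
      s * ∑ a ∈ A, proximity f a r + 2 * ramificationCounting f hf r ≤
        4 * sphericalCharacteristic f r + log M + C := by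
  obtain ⟨C, hC⟩ := exists_sum_log_one_div_chordalDist_le A hs
  refine ⟨C + log π - 2 * log ‖meromorphicTrailingCoeffAt (deriv f) 0‖, fun r hr M hM hWM ↦ ?_⟩
  let L₁ : ℂ → ℝ := fun z ↦ ∑ a ∈ A, log (1 / chordalDist (f z) a)
  let L₂ : ℂ → ℝ := fun z ↦ log √(1 + ‖f z‖ ^ 2)
  let L₃ : ℂ → ℝ := fun z ↦ log ‖deriv f z‖
  have h₁ : CircleIntegrable L₁ 0 r :=
    CircleIntegrable.fun_sum A fun a _ ↦ circleIntegrable_log_one_div_chordalDist hf hconst a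
  have h₂ : CircleIntegrable L₂ 0 r := circleIntegrable_log_sqrt hf r
  have h₃ : CircleIntegrable L₃ 0 r := hf.deriv.meromorphicOn.circleIntegrable_log_norm
  have h₄ := circleIntegrable_const (-C - log π) 0 r
  let L : ℂ → ℝ := s • L₁ + (-4 : ℝ) • L₂ + (2 : ℝ) • L₃ + fun _ ↦ (-C - log π)
  have hLi : CircleIntegrable L 0 r :=
    (((h₁.const_smul).add (h₂.const_smul)).add (h₃.const_smul)).add h₄
  have hLavg : circleAverage L 0 r = s * circleAverage L₁ 0 r - 4 * circleAverage L₂ 0 r +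
      2 * circleAverage L₃ 0 r + (-C - log π) := by
    have e1 : CircleIntegrable (s • L₁) 0 r := h₁.const_smul
    have e2 : CircleIntegrable ((-4 : ℝ) • L₂) 0 r := h₂.const_smul
    have e3 : CircleIntegrable ((2 : ℝ) • L₃) 0 r := h₃.const_smul
    rw [circleAverage_add ((e1.add e2).add e3) h₄, circleAverage_add (e1.add e2) e3,
      circleAverage_add e1 e2, circleAverage_smul, circleAverage_smul, circleAverage_smul,
      circleAverage_const]
    simp only [smul_eq_mul]
    ring
  have hLW : ∀ᶠ z in codiscrete ℂ, 0 < pullbackDensity f A s z ∧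
      L z ≤ log (pullbackDensity f A s z) := by
    have hA : ∀ᶠ z in codiscrete ℂ, ∀ a ∈ A, (f z : OnePoint ℂ) ≠ a :=
      (Finset.eventually_all A).2 fun a _ ↦ eventually_codiscrete_ne hf hconst a
    filter_upwards [hA, eventually_codiscrete_deriv_ne_zero hf hconst] with z hz hd
    have hp : 0 < targetWeight A s (f z) := one_pos.trans_le (one_le_targetWeight A s _)
    have hq := sphereDensity_pos (f z)
    have hd' : 0 < ‖deriv f z‖ := norm_pos_iff.2 hd
    refine ⟨by rw [pullbackDensity]; positivity, ?_⟩
    rw [pullbackDensity, Real.log_mul (by positivity) (by positivity),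
      Real.log_mul hp.ne' hq.ne', Real.log_pow, log_sphereDensity]
    have := hC (f z) hz
    simp only [L, L₁, L₂, L₃, Pi.add_apply, Pi.smul_apply, smul_eq_mul]
    push_cast
    linarith
  have hmain := circleAverage_le_log hr.ne' hM (pullbackDensity_nonneg A s)
    (measurable_pullbackDensity hf A s) hLi hLW hWM
  have hL₁ : circleAverage L₁ 0 r = ∑ a ∈ A, proximity f a r :=
    circleAverage_fun_sum fun a _ ↦ circleIntegrable_log_one_div_chordalDist hf hconst a
  have hL₂ : circleAverage L₂ 0 r = proximity f OnePoint.infty r := (proximity_infty r).symm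
  have hL₃ := circleAverage_log_norm_deriv hf hconst hr.ne'
  rw [hLavg, hL₁, hL₂] at hmain
  simp only [L₃] at hmain
  rw [hL₃] at hmain
  rw [sphericalCharacteristic]
  linarith

/-! ### The error term -/

lemma tendsto_sphericalCharacteristic (hf : Meromorphic f)
    (hconst : ¬ ∃ c : ℂ, f =ᶠ[codiscrete ℂ] fun _ ↦ c) :
    Tendsto (sphericalCharacteristic f) atTop atTop := by
  obtain ⟨C, hC⟩ := exists_log_sub_le_sphericalCharacteristic hf hconst
  exact tendsto_atTop_mono' _ hC (tendsto_atTop_add_const_right _ (-C) tendsto_log_atTop)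

lemma tendsto_characteristic (hf : Meromorphic f)
    (hconst : ¬ ∃ c : ℂ, f =ᶠ[codiscrete ℂ] fun _ ↦ c) :
    Tendsto (characteristic f) atTop atTop := by
  obtain ⟨C, hC⟩ := exists_abs_characteristic_sub_le hf hconst
  refine tendsto_atTop_mono' _ ?_
    (tendsto_atTop_add_const_right _ (-C) (tendsto_sphericalCharacteristic hf hconst))
  filter_upwards [eventually_gt_atTop 0] with r hr
  have := (abs_le.1 (hC r hr.ne')).1
  linarith

/-- Off a set of finite measure, the integral of `pullbackDensity` over a circle is at most a small
power of the radius times a power of the characteristic. -/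
lemma exists_lintegral_pullbackDensity_le (hf : Meromorphic f)
    (hconst : ¬ ∃ c : ℂ, f =ᶠ[codiscrete ℂ] fun _ ↦ c) (A : Finset (OnePoint ℂ)) {s δ : ℝ}
    (hs : 0 < s) (hs2 : s < 2) (hδ : 0 < δ) (hδ1 : δ ≤ 1) :
    ∃ E : Set ℝ, volume E < ⊤ ∧ ∃ c : ℝ, 0 < c ∧ ∀ᶠ r in atTop, r ∉ E →
      ∫⁻ θ in Set.Ioo (-π) π, ENNReal.ofReal (pullbackDensity f A s (circleMap 0 r θ)) ≤
        ENNReal.ofReal (2 * π * ((2 * r) ^ δ * (c * sphericalCharacteristic f r) ^ 4)) := by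
  obtain ⟨C₁, C₂, hC₁, hC⟩ := exists_lintegral_area_le hf hconst A hs hs2
  let F : ℂ → ENNReal := fun z ↦ ENNReal.ofReal (pullbackDensity f A s z)
  have hF : Measurable F := (measurable_pullbackDensity hf A s).ennreal_ofReal
  have hK : ∀ r, 1 ≤ r → logMean (radialMass F) r ≤
      ENNReal.ofReal (C₁ * sphericalCharacteristic f r + C₂) := fun r hr ↦ by
    rw [← lintegral_log_mul_eq_logMean hF]
    exact hC r hr
  obtain ⟨E, hE, hψ⟩ := exists_le_logMean (measurable_radialMass hF)
    (fun r hr ↦ ((hK r hr).trans_lt ENNReal.ofReal_lt_top).ne) hδ hδ1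
  refine ⟨E, hE, C₁ + |C₂| + 1, by positivity, ?_⟩
  filter_upwards [eventually_ge_atTop 1,
    (tendsto_sphericalCharacteristic hf hconst).eventually_ge_atTop 1] with r hr hT hrE
  set T := sphericalCharacteristic f r
  have hr0 : 0 < r := one_pos.trans_le hr
  have h1 : (logMean (radialMass F) r).toReal + 1 ≤ (C₁ + |C₂| + 1) * T := by
    have h2 := ENNReal.toReal_mono ENNReal.ofReal_ne_top (hK r hr)
    rw [ENNReal.toReal_ofReal'] at h2
    have h3 : max (C₁ * T + C₂) 0 ≤ C₁ * T + |C₂| * T := by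
      have : |C₂| ≤ |C₂| * T := le_mul_of_one_le_right (abs_nonneg _) hT
      refine max_le ?_ (by positivity)
      linarith [le_abs_self C₂]
    linarith
  have h4 : ENNReal.ofReal r * ∫⁻ θ in Set.Ioo (-π) π, F (circleMap 0 r θ) ≤
      ENNReal.ofReal r *
        ENNReal.ofReal (2 * ((2 * r) ^ δ * ((C₁ + |C₂| + 1) * T) ^ 4)) := by
    refine (hψ r hr hrE).trans ?_
    rw [← ENNReal.ofReal_mul hr0.le]
    refine ENNReal.ofReal_le_ofReal ?_
    rw [Real.rpow_add (by positivity), Real.rpow_one]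
    calc 2 * r * (2 * r) ^ δ * ((logMean (radialMass F) r).toReal + 1) ^ 4
        ≤ 2 * r * (2 * r) ^ δ * ((C₁ + |C₂| + 1) * T) ^ 4 := by gcongr
      _ = _ := by ring
  have h5 := (ENNReal.mul_le_mul_iff_right (ENNReal.ofReal_pos.2 hr0).ne' ENNReal.ofReal_ne_top).1 h4
  refine h5.trans (ENNReal.ofReal_le_ofReal ?_)
  have : 0 ≤ (2 * r) ^ δ * ((C₁ + |C₂| + 1) * T) ^ 4 := by positivity
  nlinarith [pi_gt_three]

/-- The second main theorem with error term `η T(r)`, off an exceptional set depending on `η`. -/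
lemma exists_sum_proximity_add_le (hf : Meromorphic f)
    (hconst : ¬ ∃ c : ℂ, f =ᶠ[codiscrete ℂ] fun _ ↦ c) (A : Finset (OnePoint ℂ)) {η : ℝ}
    (hη : 0 < η) :
    ∃ E : Set ℝ, volume E < ⊤ ∧ ∀ᶠ r in atTop, r ∉ E →
      ∑ a ∈ A, proximity f a r + ramificationCounting f hf r - 2 * characteristic f r ≤
        η * characteristic f r := by
  let δ : ℝ := min (1 / 2) (η / (A.card + 4))
  have hδ : 0 < δ := lt_min (by norm_num) (by positivity)
  have hδ2 : δ ≤ 1 / 2 := min_le_left _ _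
  have hδη : (A.card + 4) * δ ≤ η := by
    have : δ ≤ η / (A.card + 4) := min_le_right _ _
    rwa [le_div_iff₀ (by positivity), mul_comm] at this
  have hs : 0 < 2 * (1 - δ) := by linarith
  obtain ⟨E, hE, c, hc, hcirc⟩ := exists_lintegral_pullbackDensity_le hf hconst A hs
    (by linarith) hδ (by linarith)
  obtain ⟨C₁, hC₁⟩ := exists_sum_proximity_le_log hf hconst A hs
  choose C₂ hC₂ using fun a ↦ exists_proximity_le hf hconst a
  obtain ⟨C₃, hC₃⟩ := exists_log_sub_le_sphericalCharacteristic hf hconst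
  obtain ⟨C₄, hC₄⟩ := exists_abs_characteristic_sub_le hf hconst
  have hT₀ := tendsto_sphericalCharacteristic hf hconst
  let B : ℝ := (δ * (log 2 + C₃) + 4 * log c + C₁) / 2 + δ * ∑ a ∈ A, C₂ a +
    (2 + (A.card + 3) * δ) * C₄
  refine ⟨E, hE, ?_⟩
  filter_upwards [hcirc, hC₃, eventually_ge_atTop 1, hT₀.eventually_ge_atTop 1,
    hT₀.eventually (Real.isLittleO_log_id_atTop.def hδ),
    (tendsto_characteristic hf hconst).eventually_ge_atTop (max (B / δ) 0)]
    with r h1 h2 hr hT₁ hlog hTB hrE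
  set T₀ := sphericalCharacteristic f r
  set T := characteristic f r
  have hr0 : 0 < r := one_pos.trans_le hr
  have hT0 : 0 < T₀ := one_pos.trans_le hT₁
  have h3 := hC₁ r hr0 _ (by positivity) (h1 hrE)
  rw [Real.log_mul (by positivity) (by positivity), Real.log_rpow (by positivity),
    Real.log_mul two_ne_zero hr0.ne', Real.log_pow, Real.log_mul hc.ne' hT0.ne'] at h3
  push_cast at h3
  have h4 : log T₀ ≤ δ * T₀ := by
    have := (le_abs_self _).trans hlog
    rwa [id, Real.norm_of_nonneg hT0.le] at this
  have h5 : ∑ a ∈ A, proximity f a r ≤ A.card * T₀ + ∑ a ∈ A, C₂ a := by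
    refine (Finset.sum_le_sum fun a _ ↦ hC₂ a r hr).trans_eq ?_
    rw [Finset.sum_add_distrib, Finset.sum_const, nsmul_eq_mul]
  have h6 := (abs_le.1 (hC₄ r hr0.ne')).1
  have h7 : B ≤ δ * T := by
    have := (le_max_left _ _).trans hTB
    rwa [div_le_iff₀ hδ, mul_comm] at this
  have h8 : 0 ≤ T := (le_max_right _ _).trans hTB
  have h9 := mul_le_mul_of_nonneg_left h5 hδ.le
  have h10 : δ * log r ≤ δ * (T₀ + C₃) := mul_le_mul_of_nonneg_left (by linarith) hδ.le
  have h11 : (2 + (A.card + 3) * δ) * T₀ ≤ (2 + (A.card + 3) * δ) * (T + C₄) :=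
    mul_le_mul_of_nonneg_left (by linarith) (by positivity)
  have h12 := mul_le_mul_of_nonneg_right hδη h8
  have h13 : 0 ≤ δ * T₀ := by positivity
  simp only [B] at h7
  -- `∑ m + N₁` is half of `s ∑ m + 2 N₁` plus `δ ∑ m`
  linarith

/-- A diagonal argument: if for each `η > 0` the inequality `X ≤ η T` holds near infinity off a set
of finite measure, then the positive part of `X` is `o(T)` off a single set of finite measure. -/
lemma exists_isLittleO_of_forall_eventually_le {X T : ℝ → ℝ} (hT : ∀ᶠ r in atTop, 0 ≤ T r)
    (h : ∀ η : ℝ, 0 < η → ∃ E : Set ℝ, volume E < ⊤ ∧ ∀ᶠ r in atTop, r ∉ E → X r ≤ η * T r) :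
    ∃ E : Set ℝ, E ⊆ Set.Ici 0 ∧ MeasurableSet E ∧ volume E < ⊤ ∧
      (fun r ↦ max 0 (X r)) =o[atTop ⊓ 𝓟 Eᶜ] T := by
  choose E hE hX using fun n : ℕ ↦ h (1 / (n + 1)) (by positivity)
  obtain ⟨ε, hε, hεsum⟩ := ENNReal.exists_pos_sum_of_countable' one_ne_zero ℕ
  -- far enough out, the `n`-th exceptional set has measure less than `ε n`
  have htail : ∀ n, ∃ ρ : ℝ, 0 ≤ ρ ∧ volume (toMeasurable volume (E n) ∩ Set.Ici ρ) < ε n := by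
    intro n
    have hlim := tendsto_measure_iInter_atTop (μ := volume)
      (s := fun ρ : ℝ ↦ toMeasurable volume (E n) ∩ Set.Ici ρ)
      (fun ρ ↦ ((measurableSet_toMeasurable _ _).inter measurableSet_Ici).nullMeasurableSet)
      (fun ρ σ hρσ ↦ Set.inter_subset_inter_right _ (Set.Ici_subset_Ici.2 hρσ))
      ⟨0, ((measure_mono Set.inter_subset_left).trans_lt
        ((measure_toMeasurable (E n)).trans_lt (hE n))).ne⟩
    have hempty : ⋂ ρ : ℝ, toMeasurable volume (E n) ∩ Set.Ici ρ = ∅ := by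
      refine Set.eq_empty_of_forall_notMem fun x hx ↦ ?_
      have := (Set.mem_iInter.1 hx (x + 1)).2
      rw [Set.mem_Ici] at this
      linarith
    rw [hempty, measure_empty] at hlim
    obtain ⟨ρ, hρ, hρ0⟩ := ((hlim.eventually_lt_const (hε n)).and (eventually_ge_atTop 0)).exists
    exact ⟨ρ, hρ0, hρ⟩
  choose ρ hρ hvol using htail
  let G : Set ℝ := ⋃ n, toMeasurable volume (E n) ∩ Set.Ici (ρ n)
  refine ⟨G, Set.iUnion_subset fun n ↦ Set.inter_subset_right.trans (Set.Ici_subset_Ici.2 (hρ n)),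
    MeasurableSet.iUnion fun n ↦ (measurableSet_toMeasurable _ _).inter measurableSet_Ici,
    (measure_iUnion_le _).trans_lt ((ENNReal.tsum_le_tsum fun n ↦ (hvol n).le).trans_lt
      (hεsum.trans ENNReal.one_lt_top)), ?_⟩
  refine Asymptotics.isLittleO_iff.2 fun η hη ↦ ?_
  obtain ⟨n, hn⟩ := exists_nat_one_div_lt hη
  rw [eventually_inf_principal]
  filter_upwards [hT, hX n, eventually_ge_atTop (ρ n)] with r hTr hr hρr hrG
  have hrE : r ∉ E n := fun hr' ↦
    hrG (Set.mem_iUnion.2 ⟨n, subset_toMeasurable _ _ hr', hρr⟩)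
  rw [Real.norm_of_nonneg (le_max_left _ _), Real.norm_of_nonneg hTr]
  exact max_le (by positivity) ((hr hrE).trans (by gcongr))

end Nevanlinna

theorem mainTheorem2 (f : ℂ → ℂ) (hf : Meromorphic f)
    (hconst : ¬ ∃ c : ℂ, f =ᶠ[codiscrete ℂ] fun _ ↦ c) (A : Finset (OnePoint ℂ)) :
    ∃ S : ℝ → ℝ,
      (∀ r : ℝ, 0 < r →
        (∑ a ∈ A, Nevanlinna.proximity f a r) + Nevanlinna.ramificationCounting f hf r
          ≤ 2 * Nevanlinna.characteristic f r + S r) ∧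
      ∃ E : Set ℝ, E ⊆ Set.Ici 0 ∧ MeasurableSet E ∧ volume E < ⊤ ∧
        S =o[atTop ⊓ 𝓟 Eᶜ] Nevanlinna.characteristic f := by
  -- the least nonnegative error term
  refine ⟨fun r ↦ max 0 (∑ a ∈ A, Nevanlinna.proximity f a r +
    Nevanlinna.ramificationCounting f hf r - 2 * Nevanlinna.characteristic f r), fun r _ ↦ ?_,
    Nevanlinna.exists_isLittleO_of_forall_eventually_le
      ((Nevanlinna.tendsto_characteristic hf hconst).eventually_ge_atTop 0)
      fun η hη ↦ Nevanlinna.exists_sum_proximity_add_le hf hconst A hη⟩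
  linarith [le_max_right 0 (∑ a ∈ A, Nevanlinna.proximity f a r +
    Nevanlinna.ramificationCounting f hf r - 2 * Nevanlinna.characteristic f r)]
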